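/- **Setting.** Let $\phi:\mathcal S\times\mathcal A\to\mathbb R^{d_1}$, $\psi_0:\mathcal X\to\mathbb R$, $\psi:\mathcal X\to\mathbb R^{d_2}$ be known measurable feature maps, $r_\theta(s,a)=\theta^\top\phi(s,a)$, $\sigma_\gamma(x)=\psi_0(x)+\gamma^\top\psi(x)$ and $\mu(v)=1/(1+e^{-v})$. Let $\phi_{\max},\theta_{\max},\psi_{\max},\gamma_{\max}>0$ and assume $\|\phi(s,a)\|_2\le\phi_{\max}$ for all $s,a$; $\|\theta_*\|_\infty\le\theta_{\max}$; $\psi_0\not\equiv0$; $\|(\psi_0(x),\psi(x)^\top)\|_2\le\psi_{\max}$ for all $x$; and $\|(1,\gamma_*^\top)\|_\infty\le\gamma_{\max}$. A comparison $(x,s,a^{(0)},a^{(1)})$ has law $\nu$, we write $z=\phi(s,a^{(1)})-\phi(s,a^{(0)})$, and given the comparison the label $Y\in\{0,1\}$ satisfies $$\mathbb P(Y=1\mid x,s,a^{(0)},a^{(1)})=\mu\big(\sigma_{\gamma_*}(x)[r_{\theta_*}(s,a^{(1)})-r_{\theta_*}(s,a^{(0)})]\big).$$ Assume that the smallest eigenvalues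 of $\mathbb E[\sigma_{\gamma_*}^2(x)zz^\top]$ and of $\mathbb E[(\theta_*^\top z)^2\psi(x)\psi(x)^\top]$ are $\lambda_\phi>0$ and $\lambda_\psi>0$. With $u=\sigma_{\gamma_*}(x)\theta_*^\top z$ let $$M=\big\|\mathbb E\{\mu(u)[1-\mu(u)]\,\sigma_{\gamma_*}(x)(\theta_*^\top z)\,\psi(x)z^\top\}\big\|_2$$ (spectral norm), and assume $M<\min\{\lambda_\phi,\lambda_\psi\}/(6c_0)$, where $c_0=(1+e^{C_{\max}})^2/e^{C_{\max}}$, $$C_{\max}=(\sqrt2\gamma_{\max}+\tilde b)(\sqrt2\theta_{\max}+\tilde b)\sqrt{d_1(d_2+1)}\,\phi_{\max}\psi_{\max},\qquad \tilde b=\frac{\min\{\lambda_\phi/(\sqrt{d_2}\gamma_{\max}),\ \lambda_\psi/(\sqrt{d_1}\theta_{\max})\}}{8\sqrt2\,\phi_{\max}^2\psi_{\max}^2}.$$ **Algorithm.** Given $n$ i.i.d. samples $(x_i,s_i,a_i^{(0)},a_i^{(1)},y_i)$ of this model, let $$L_n(\theta,\gamma)=-\frac1n\sum_{i=1}^n\{y_i\log\mu(v_i)+(1-y_i)\log[1-\mu(v_i)]\},\qquad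 v_i=\sigma_\gamma(x_i)[r_\theta(s_i,a_i^{(1)})-r_\theta(s_i,a_i^{(0)})].$$ From initial points $\theta_0,\gamma_0$ and with step sizes $\eta_1,\eta_2$, iterate for $t=1,\dots,T$ $$\theta_t=\theta_{t-1}-\eta_1\nabla_\theta L_n(\theta_{t-1},\gamma_{t-1}),\qquad \gamma_t=\gamma_{t-1}-\eta_2\nabla_\gamma L_n(\theta_t,\gamma_{t-1}).$$ **Theorem.** There are positive constants $b_0,\eta_0,n_0$, for every $\bar\delta\in(0,1)$ a positive constant $c_1=c_1(\bar\delta)$, and for all $\eta_1,\eta_2\in(0,\eta_0)$ a $\rho=\rho(\eta_1,\eta_2)\in(0,1)$, all of which otherwise depend only on $d_1,d_2,\phi_{\max},\theta_{\max},\psi_{\max},\gamma_{\max},\lambda_\phi,\lambda_\psi,M$, such that the following holds. If $b<b_0$, $\|\theta_0-\theta_*\|_2\le b/\sqrt2$, $\|\gamma_0-\gamma_*\|_2\le b/\sqrt2$ and $0<\eta_1,\eta_2<\eta_0$, then for all $n>n_0$, all $T\ge0$, all $\bar\delta\in(0,1)$ and all $0<\delta\le\bar\delta$, with probability at least $1-\delta-\frac1n$,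 $$\|\theta_T-\theta_*\|_2^2+\|\gamma_T-\gamma_*\|_2^2\le\rho^Tb^2+\frac{c_1(\bar\delta)\log(1/\delta)}{(1-\rho)n}.$$ -/

import Mathlib

open MeasureTheory ProbabilityTheory Set

/-- `ℝ^d` with the Euclidean norm. -/
abbrev Vec (d : ℕ) : Type := EuclideanSpace ℝ (Fin d)

/-- A comparison `(x, s, a⁽⁰⁾, a⁽¹⁾)`: teacher context, prompt, and the two candidate responses. -/
abbrev Comparison (𝒳 𝒮 𝒜 : Type*) : Type _ := 𝒳 × 𝒮 × 𝒜 × 𝒜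

/-- The known (measurable) feature maps `φ`, `ψ₀`, `ψ`. -/
structure FeatureMaps (𝒳 𝒮 𝒜 : Type*) [MeasurableSpace 𝒳] [MeasurableSpace 𝒮]
    [MeasurableSpace 𝒜] (d₁ d₂ : ℕ) where
  φ : 𝒮 → 𝒜 → Vec d₁
  ψ₀ : 𝒳 → ℝ
  ψ : 𝒳 → Vec d₂
  measurable_φ : Measurable (fun p : 𝒮 × 𝒜 => φ p.1 p.2)
  measurable_ψ₀ : Measurable ψ₀
  measurable_ψ : Measurable ψ

namespace FeatureMaps

variable {𝒳 𝒮 𝒜 : Type*} [MeasurableSpace 𝒳] [MeasurableSpace 𝒮] [MeasurableSpace 𝒜]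
  {d₁ d₂ : ℕ} (F : FeatureMaps 𝒳 𝒮 𝒜 d₁ d₂)

/-- Linear reward `r_θ(s, a) = θᵀ φ(s, a)`. -/
noncomputable def reward (θ : Vec d₁) (s : 𝒮) (a : 𝒜) : ℝ := inner ℝ θ (F.φ s a)

/-- Linear scale function `σ_γ(x) = ψ₀(x) + γᵀ ψ(x)`. -/
noncomputable def scale (γ : Vec d₂) (x : 𝒳) : ℝ := F.ψ₀ x + inner ℝ γ (F.ψ x)

/-- `z = φ(s, a⁽¹⁾) - φ(s, a⁽⁰⁾)`. -/
noncomputable def featureDiff (c : Comparison 𝒳 𝒮 𝒜) : Vec d₁ :=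
  F.φ c.2.1 c.2.2.2 - F.φ c.2.1 c.2.2.1

/-- The logit `σ_γ(x) (r_θ(s, a⁽¹⁾) - r_θ(s, a⁽⁰⁾))` of the preference probability. -/
noncomputable def logit (θ : Vec d₁) (γ : Vec d₂) (c : Comparison 𝒳 𝒮 𝒜) : ℝ :=
  F.scale γ c.1 * (F.reward θ c.2.1 c.2.2.2 - F.reward θ c.2.1 c.2.2.1)

/-- Bounded features, and a true reward parameter in the box `‖θ‖_∞ ≤ θmax`. -/
structure BoundedReward (θs : Vec d₁) (φmax θmax : ℝ) : Prop where
  feature_bound : ∀ s a, ‖F.φ s a‖ ≤ φmax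
  param_bound : ∀ j, |θs j| ≤ θmax

/-- `ψ₀ ≢ 0`, `‖(ψ₀(x), ψ(x))‖₂ ≤ ψmax` for all `x`, and `‖(1, γ_*)‖_∞ ≤ γmax`. -/
structure BoundedScale (γs : Vec d₂) (ψmax γmax : ℝ) : Prop where
  base_ne_zero : ∃ x, F.ψ₀ x ≠ 0
  feature_bound : ∀ x, Real.sqrt (F.ψ₀ x ^ 2 + ‖F.ψ x‖ ^ 2) ≤ ψmax
  one_le : 1 ≤ γmax
  param_bound : ∀ j, |γs j| ≤ γmax

/-- The matrix `E[σ_{γ_*}(x)² z zᵀ]`, where `ν` is the law of a comparison. -/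
noncomputable def rewardDesign (ν : Measure (Comparison 𝒳 𝒮 𝒜)) (γs : Vec d₂) :
    Matrix (Fin d₁) (Fin d₁) ℝ :=
  Matrix.of fun i j =>
    ∫ c, F.scale γs c.1 ^ 2 * (F.featureDiff c i * F.featureDiff c j) ∂ν

/-- The matrix `E[(θ_*ᵀ z)² ψ(x) ψ(x)ᵀ]`. -/
noncomputable def scaleDesign (ν : Measure (Comparison 𝒳 𝒮 𝒜)) (θs : Vec d₁) :
    Matrix (Fin d₂) (Fin d₂) ℝ :=
  Matrix.of fun i j =>
    ∫ c, (inner ℝ θs (F.featureDiff c) : ℝ) ^ 2 * (F.ψ c.1 i * F.ψ c.1 j) ∂ν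

/-- The matrix `E[μ(u)(1 - μ(u)) σ_{γ_*}(x) (θ_*ᵀ z) ψ(x) zᵀ]` with `u = σ_{γ_*}(x) θ_*ᵀ z`. -/
noncomputable def crossMatrix (ν : Measure (Comparison 𝒳 𝒮 𝒜)) (θs : Vec d₁) (γs : Vec d₂) :
    Matrix (Fin d₂) (Fin d₁) ℝ :=
  Matrix.of fun i j =>
    ∫ c, Real.sigmoid (F.scale γs c.1 * inner ℝ θs (F.featureDiff c))
      * (1 - Real.sigmoid (F.scale γs c.1 * inner ℝ θs (F.featureDiff c)))
      * F.scale γs c.1 * inner ℝ θs (F.featureDiff c)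
      * (F.ψ c.1 i * F.featureDiff c j) ∂ν

open scoped Matrix.Norms.L2Operator in
/-- The cross-coupling `M`: the spectral (`ℓ² → ℓ²` operator) norm of `crossMatrix`. -/
noncomputable def coupling (ν : Measure (Comparison 𝒳 𝒮 𝒜)) (θs : Vec d₁) (γs : Vec d₂) : ℝ :=
  ‖F.crossMatrix ν θs γs‖

/-- `lamφ` and `lamψ` are the smallest eigenvalues of the two design matrices. -/
structure DesignEigenvalues (ν : Measure (Comparison 𝒳 𝒮 𝒜)) (θs : Vec d₁) (γs : Vec d₂)
    (lamφ lamψ : ℝ) : Prop where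
  reward : IsLeast (spectrum ℝ (F.rewardDesign ν γs)) lamφ
  scale : IsLeast (spectrum ℝ (F.scaleDesign ν θs)) lamψ

/-- `(ctx i, Y i)`, `i < n`, are i.i.d. samples of the preference model: the comparison `ctx i` has
law `ν`, and given `ctx i` the label `Y i ∈ {0, 1}` equals `1` with probability
`μ(σ_{γ_*}(x) (r_{θ_*}(s, a⁽¹⁾) - r_{θ_*}(s, a⁽⁰⁾)))`. -/
structure IsPreferenceSample {Ω : Type*} [MeasurableSpace Ω] (P : Measure Ω)
    (ν : Measure (Comparison 𝒳 𝒮 𝒜)) (θs : Vec d₁) (γs : Vec d₂) {n : ℕ}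
    (ctx : Fin n → Ω → Comparison 𝒳 𝒮 𝒜) (Y : Fin n → Ω → ℝ) : Prop where
  measurable_ctx : ∀ i, Measurable (ctx i)
  measurable_label : ∀ i, Measurable (Y i)
  label_mem : ∀ i ω, Y i ω = 0 ∨ Y i ω = 1
  indep : iIndepFun (fun i ω => (ctx i ω, Y i ω)) P
  ctx_law : ∀ i, P.map (ctx i) = ν
  label_law : ∀ i, P⟦Y i ⁻¹' {1} | MeasurableSpace.comap (ctx i) inferInstance⟧
    =ᵐ[P] fun ω => Real.sigmoid (F.logit θs γs (ctx i ω))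

/-- The negative log-likelihood `L_n(θ, γ)` of the data `(c i, y i)`, `i < n`. -/
noncomputable def negLogLik {n : ℕ} (c : Fin n → Comparison 𝒳 𝒮 𝒜) (y : Fin n → ℝ)
    (θ : Vec d₁) (γ : Vec d₂) : ℝ :=
  -(1 / (n : ℝ)) * ∑ i, (y i * Real.log (Real.sigmoid (F.logit θ γ (c i)))
    + (1 - y i) * Real.log (1 - Real.sigmoid (F.logit θ γ (c i))))

end FeatureMaps

/-- Alternating gradient descent: `θ_t = θ_{t-1} - η₁ ∇_θ L(θ_{t-1}, γ_{t-1})`, and then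
`γ_t = γ_{t-1} - η₂ ∇_γ L(θ_t, γ_{t-1})`. The value at `t` is `(θ_t, γ_t)`. -/
noncomputable def altGD {d₁ d₂ : ℕ} (L : Vec d₁ → Vec d₂ → ℝ) (η₁ η₂ : ℝ)
    (θ₀ : Vec d₁) (γ₀ : Vec d₂) : ℕ → Vec d₁ × Vec d₂
  | 0 => (θ₀, γ₀)
  | t + 1 =>
    let p := altGD L η₁ η₂ θ₀ γ₀ t
    let θ' := p.1 - η₁ • gradient (fun θ => L θ p.2) p.1
    (θ', p.2 - η₂ • gradient (fun γ => L θ' γ) p.2)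

/-- `b̃ = min{λ_φ / (√d₂ γmax), λ_ψ / (√d₁ θmax)} / (8 √2 φmax² ψmax²)`. -/
noncomputable def bTilde (d₁ d₂ : ℕ) (φmax θmax ψmax γmax lamφ lamψ : ℝ) : ℝ :=
  min (lamφ / (Real.sqrt d₂ * γmax)) (lamψ / (Real.sqrt d₁ * θmax))
    / (8 * Real.sqrt 2 * φmax ^ 2 * ψmax ^ 2)

/-- `C_max = (√2 γmax + b̃) (√2 θmax + b̃) √(d₁ (d₂ + 1)) φmax ψmax`. -/
noncomputable def logitBound (d₁ d₂ : ℕ) (φmax θmax ψmax γmax lamφ lamψ : ℝ) : ℝ :=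
  (Real.sqrt 2 * γmax + bTilde d₁ d₂ φmax θmax ψmax γmax lamφ lamψ)
    * (Real.sqrt 2 * θmax + bTilde d₁ d₂ φmax θmax ψmax γmax lamφ lamψ)
    * Real.sqrt (d₁ * (d₂ + 1)) * φmax * ψmax

/-- `c₀ = (1 + exp C_max)² / exp C_max`. -/
noncomputable def curvatureConst (d₁ d₂ : ℕ) (φmax θmax ψmax γmax lamφ lamψ : ℝ) : ℝ :=
  (1 + Real.exp (logitBound d₁ d₂ φmax θmax ψmax γmax lamφ lamψ)) ^ 2
    / Real.exp (logitBound d₁ d₂ φmax θmax ψmax γmax lamφ lamψ)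

/-!
The error of alternating gradient descent is measured by the larger of the two block errors
`‖θ_t - θ_*‖` and `‖γ_t - γ_*‖`. The Euclidean norm of the pair is unsuitable: with very different
step sizes the two block steps need not contract it. In the maximum norm each block step contracts on
its own. Linearizing the gradient at the truth, a step in the block `θ` maps the error `h` to
`h - η₁ (A h + Bᵀ k + noise + remainder)`, where `A` and `B` are blocks of the empirical Hessian at
`(θ_*, γ_*)` and `k` is the error of the other block. If `A` is `lam`-coercive, `‖B‖ ≤ m` with
`m < lam / 2`, and both errors are at most a small radius `R`, the new error is at most
`(1 - η₁ a) R + η₁ ε`, where `ε` bounds the gradient noise at the truth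
(`norm_sub_smul_blockGrad_le`). The block `γ` is the same statement with the roles of
`(σ_{γ_*}, ψ)` and `(θ_*ᵀ z, z)` exchanged. Iterating, both errors are at most
`(1 - a min(η₁, η₂)) ^ t * E₀ + ε / a` (`norm_le_of_alternating_contraction`), and starting both in
a ball of radius `E₀ = b / √2` turns this into the claimed bound, with `ρ = 1 - a min(η₁, η₂)`
(`FeatureMaps.norm_altGD_sub_sq_add_le`).

The population Hessian at the truth satisfies these conditions: the logits there are at most
`C_max`, so that `μ(1 - μ) ≥ 1 / c₀` and the diagonal blocks are `min(λ_φ, λ_ψ) / c₀`-coercive,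
while the off-diagonal block has norm `M < min(λ_φ, λ_ψ) / (6 c₀)`; the second derivatives of the
logits enter multiplied by the residual `μ(u) - Y`, which is centred given the comparison
(`FeatureMaps.integral_residual_mul_eq_zero`). Hoeffding's inequality, applied to the entries,
transfers this to the sample, and also bounds the noise. Fixed accuracies, which keep the Hessian
well conditioned and the iterates inside the ball, fail with exponentially small probability, at
most `1 / n` for large `n`; the noise level of order `√(log(1/δ) / n)` fails with probability at
most `δ` (`FeatureMaps.one_sub_le_measure_altGD_error_le`).
-/

/-! ### The logistic function -/

namespace Real

theorem sigmoid_mul_one_sub_nonneg (x : ℝ) : 0 ≤ sigmoid x * (1 - sigmoid x) :=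
  mul_nonneg (sigmoid_nonneg x) (sub_nonneg.2 (sigmoid_le_one x))

theorem sigmoid_mul_one_sub_le_one (x : ℝ) : sigmoid x * (1 - sigmoid x) ≤ 1 := by
  nlinarith [sq_nonneg (sigmoid x - 1 / 2)]

theorem abs_sigmoid_sub_le (x y : ℝ) : |sigmoid x - sigmoid y| ≤ |x - y| := by
  have h := Convex.norm_image_sub_le_of_norm_hasDerivWithin_le (f := sigmoid)
    (f' := fun x => sigmoid x * (1 - sigmoid x)) (C := 1) (s := univ) (x := y) (y := x)
    (fun x _ => (hasDerivAt_sigmoid x).hasDerivWithinAt)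
    (fun x _ => by
      rw [norm_eq_abs, abs_of_nonneg (sigmoid_mul_one_sub_nonneg x)]
      exact sigmoid_mul_one_sub_le_one x) convex_univ (mem_univ _) (mem_univ _)
  simpa using h

/-- The logistic derivative `μ(1 - μ)` is `1`-Lipschitz. -/
theorem abs_sigmoid_mul_one_sub_sub_le (x y : ℝ) :
    |sigmoid x * (1 - sigmoid x) - sigmoid y * (1 - sigmoid y)| ≤ |x - y| := by
  have h : sigmoid x * (1 - sigmoid x) - sigmoid y * (1 - sigmoid y)
      = (sigmoid x - sigmoid y) * (1 - sigmoid x - sigmoid y) := by ring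
  rw [h, abs_mul]
  have h1 : |1 - sigmoid x - sigmoid y| ≤ 1 := by
    rw [abs_le]
    constructor <;>
      linarith [sigmoid_nonneg x, sigmoid_nonneg y, sigmoid_le_one x, sigmoid_le_one y]
  calc _ ≤ |x - y| * 1 := mul_le_mul (abs_sigmoid_sub_le x y) h1 (abs_nonneg _) (abs_nonneg _)
    _ = _ := mul_one _

/-- First-order Taylor expansion of the logistic function, with a uniform quadratic remainder. -/
theorem abs_sigmoid_sub_sub_le (x y : ℝ) :
    |sigmoid x - sigmoid y - sigmoid y * (1 - sigmoid y) * (x - y)| ≤ (x - y) ^ 2 := by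
  have h := Convex.norm_image_sub_le_of_norm_hasDerivWithin_le
    (f := fun x => sigmoid x - sigmoid y * (1 - sigmoid y) * x)
    (f' := fun x => sigmoid x * (1 - sigmoid x) - sigmoid y * (1 - sigmoid y))
    (C := |x - y|) (s := uIcc y x) (x := y) (y := x)
    (fun w _ => by
      simpa using ((hasDerivAt_sigmoid w).fun_sub
        ((hasDerivAt_id w).const_mul (sigmoid y * (1 - sigmoid y)))).hasDerivWithinAt)
    (fun w hw => (abs_sigmoid_mul_one_sub_sub_le w y).trans (abs_sub_left_of_mem_uIcc hw))
    (convex_uIcc _ _) left_mem_uIcc right_mem_uIcc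
  simp only [norm_eq_abs] at h
  rw [abs_mul_abs_self, ← sq] at h
  refine le_trans (le_of_eq ?_) h
  congr 1
  ring

/-- On `[-C, C]` the logistic derivative `μ(1 - μ)` is at least its value at `C`. -/
theorem exp_div_le_sigmoid_mul_one_sub {x C : ℝ} (h : |x| ≤ C) :
    exp C / (1 + exp C) ^ 2 ≤ sigmoid x * (1 - sigmoid x) := by
  have key : ∀ w : ℝ, sigmoid w * (1 - sigmoid w) = (2 + exp w + exp (-w))⁻¹ := by
    intro w
    rw [sigmoid_def]
    have : exp (-w) * exp w = 1 := by rw [← exp_add]; simp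
    have h1 := exp_pos w
    have h2 := exp_pos (-w)
    field_simp
    linear_combination this
  have keyC : exp C / (1 + exp C) ^ 2 = (2 + exp C + exp (-C))⁻¹ := by
    have : exp (-C) * exp C = 1 := by rw [← exp_add]; simp
    have h1 := exp_pos C
    have h2 := exp_pos (-C)
    field_simp
    linear_combination this
  rw [key, keyC]
  have h1 : exp x + exp (-x) ≤ exp C + exp (-C) := by
    have := cosh_le_cosh.2 (h.trans (le_abs_self C))
    rw [cosh_eq, cosh_eq] at this
    linarith
  apply inv_anti₀
  · positivity
  · linarith

end Real

/-! ### One gradient step in one block -/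

section BlockUpdate

variable {E E' : Type*} [NormedAddCommGroup E] [InnerProductSpace ℝ E]
  [NormedAddCommGroup E'] [InnerProductSpace ℝ E'] {n : ℕ}

/-- An average of vectors of norm at most `C` has norm at most `C`. -/
theorem norm_average_le (hn : 0 < n) {C : ℝ} {f : Fin n → E} (hf : ∀ i, ‖f i‖ ≤ C) :
    ‖(1 / (n : ℝ)) • ∑ i, f i‖ ≤ C := by
  have hn' : (0 : ℝ) < n := by exact_mod_cast hn
  rw [norm_smul, Real.norm_of_nonneg (by positivity)]
  have : ‖∑ i, f i‖ ≤ n * C := by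
    refine (norm_sum_le _ _).trans ((Finset.sum_le_sum fun i _ => hf i).trans ?_)
    simp
  calc _ ≤ 1 / (n : ℝ) * (n * C) := by gcongr
    _ = C := by field_simp

/-- The partial gradient, in the block `h`, of the logistic loss with bilinear logits
`(sᵢ + ⟨bᵢ, k⟩) (tᵢ + ⟨aᵢ, h⟩)`. The loss of the model, centred at the true parameter, has this
form in each of its two blocks, with the roles of `(s, b)` and `(t, a)` exchanged. -/
noncomputable def blockGrad (s t y : Fin n → ℝ) (a : Fin n → E) (b : Fin n → E') (h : E) (k : E') :
    E :=
  (1 / (n : ℝ)) • ∑ i, ((Real.sigmoid ((s i + inner ℝ (b i) k) * (t i + inner ℝ (a i) h)) - y i)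
    * (s i + inner ℝ (b i) k)) • a i

/-- A gradient step for a `lam`-coercive linear map of norm at most `Λ`. -/
theorem norm_sub_smul_le_of_inner_ge {h v : E} {lam Λ η : ℝ} (hη : 0 ≤ η)
    (hcoer : lam * ‖h‖ ^ 2 ≤ inner ℝ h v) (hv : ‖v‖ ≤ Λ * ‖h‖)
    (hη1 : η * Λ ^ 2 ≤ lam) (hη2 : η * lam ≤ 2) :
    ‖h - η • v‖ ≤ (1 - η * lam / 2) * ‖h‖ := by
  have h0 : 0 ≤ (1 - η * lam / 2) * ‖h‖ := mul_nonneg (by linarith) (norm_nonneg _)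
  refine abs_le_of_sq_le_sq' ?_ h0 |>.2
  rw [norm_sub_sq_real, inner_smul_right, norm_smul, Real.norm_of_nonneg hη]
  have h1 : ‖v‖ ^ 2 ≤ Λ ^ 2 * ‖h‖ ^ 2 := by
    rw [← mul_pow]
    exact pow_le_pow_left₀ (norm_nonneg _) hv 2
  have h2 : η ^ 2 * ‖v‖ ^ 2 ≤ η * lam * ‖h‖ ^ 2 := by
    calc η ^ 2 * ‖v‖ ^ 2 ≤ η ^ 2 * (Λ ^ 2 * ‖h‖ ^ 2) := by gcongr
      _ = η * (η * Λ ^ 2) * ‖h‖ ^ 2 := by ring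
      _ ≤ η * lam * ‖h‖ ^ 2 := by gcongr
  have h3 : η * (lam * ‖h‖ ^ 2) ≤ η * inner ℝ h v := by gcongr
  nlinarith [sq_nonneg (η * lam * ‖h‖)]

/-- The remainder after linearizing one summand of `blockGrad`. -/
theorem abs_blockGrad_remainder_le {K R s t y p q : ℝ} (hK : 1 ≤ K) (hR : R ≤ 1)
    (hs : |s| ≤ K) (ht : |t| ≤ K) (hp : |p| ≤ K * R) (hq : |q| ≤ K * R) :
    |(Real.sigmoid ((s + p) * (t + q)) - y) * (s + p)
      - ((Real.sigmoid (s * t) - y) * s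
        + Real.sigmoid (s * t) * (1 - Real.sigmoid (s * t)) * s ^ 2 * q
        + (Real.sigmoid (s * t) * (1 - Real.sigmoid (s * t)) * (s * t)
            + (Real.sigmoid (s * t) - y)) * p)| ≤ 13 * K ^ 5 * R ^ 2 := by
  have hR0 : 0 ≤ R := by
    by_contra hneg
    have := (abs_nonneg p).trans hp
    nlinarith
  set u := s * t with hu
  set v := (s + p) * (t + q) with hv
  set d := Real.sigmoid u * (1 - Real.sigmoid u) with hd
  have hd0 : |d| ≤ 1 := by
    rw [abs_of_nonneg (Real.sigmoid_mul_one_sub_nonneg u)]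
    exact Real.sigmoid_mul_one_sub_le_one u
  have hvu : |v - u| ≤ 3 * K ^ 2 * R := by
    have e : v - u = s * q + p * t + p * q := by rw [hu, hv]; ring
    rw [e]
    have h1 : |s * q| ≤ K * (K * R) := by rw [abs_mul]; gcongr
    have h2 : |p * t| ≤ (K * R) * K := by rw [abs_mul]; gcongr
    have h3 : |p * q| ≤ (K * R) * (K * R) := by rw [abs_mul]; gcongr
    have h4 : (K * R) * (K * R) ≤ K ^ 2 * R := by nlinarith [mul_nonneg (sq_nonneg K) hR0]
    calc _ ≤ |s * q| + |p * t| + |p * q| := abs_add_three _ _ _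
      _ ≤ 3 * K ^ 2 * R := by nlinarith
  have e : (Real.sigmoid v - y) * (s + p) - ((Real.sigmoid u - y) * s + d * s ^ 2 * q
        + (d * u + (Real.sigmoid u - y)) * p)
      = d * p * q * s + (Real.sigmoid v - Real.sigmoid u - d * (v - u)) * s
        + (Real.sigmoid v - Real.sigmoid u) * p := by
    rw [hu, hv]; ring
  rw [e]
  have h1 : |d * p * q * s| ≤ 1 * (K * R) * (K * R) * K := by
    rw [abs_mul, abs_mul, abs_mul]; gcongr
  have h2 : |(Real.sigmoid v - Real.sigmoid u - d * (v - u)) * s| ≤ (3 * K ^ 2 * R) ^ 2 * K := by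
    rw [abs_mul]
    have := (Real.abs_sigmoid_sub_sub_le v u).trans (sq_le_sq' (abs_le.1 hvu).1 (abs_le.1 hvu).2)
    gcongr
  have h3 : |(Real.sigmoid v - Real.sigmoid u) * p| ≤ (3 * K ^ 2 * R) * (K * R) := by
    rw [abs_mul]
    have := (Real.abs_sigmoid_sub_le v u).trans hvu
    gcongr
  have hK3 : K ^ 3 ≤ K ^ 5 := pow_le_pow_right₀ hK (by norm_num)
  calc _ ≤ _ := abs_add_three _ _ _
    _ ≤ 1 * (K * R) * (K * R) * K + (3 * K ^ 2 * R) ^ 2 * K + (3 * K ^ 2 * R) * (K * R) := by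
        gcongr
    _ = 4 * K ^ 3 * R ^ 2 + 9 * K ^ 5 * R ^ 2 := by ring
    _ ≤ 4 * K ^ 5 * R ^ 2 + 9 * K ^ 5 * R ^ 2 := by gcongr
    _ = _ := by ring

/-- One gradient step in one block, started within `R` of the truth in both blocks, contracts the
distance of that block by `1 - η a`, up to the gradient noise `ε` at the truth. The coercivity
`lam` of the diagonal Hessian block has to beat the coupling `m` and the quadratic remainder. -/
theorem norm_sub_smul_blockGrad_le (hn : 0 < n) {s t y : Fin n → ℝ} {a : Fin n → E}
    {b : Fin n → E'} {K R lam m acon ε η : ℝ} {h : E} {k : E'} (hK : 1 ≤ K)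
    (hs : ∀ i, |s i| ≤ K) (ht : ∀ i, |t i| ≤ K) (ha : ∀ i, ‖a i‖ ≤ K) (hb : ∀ i, ‖b i‖ ≤ K)
    (hcoer : ∀ h : E, lam * ‖h‖ ^ 2 ≤ 1 / (n : ℝ) * ∑ i,
      (Real.sigmoid (s i * t i) * (1 - Real.sigmoid (s i * t i)) * s i ^ 2)
        * (inner ℝ (a i) h * inner ℝ (a i) h))
    (hcross : ∀ (h : E) (k : E'), |1 / (n : ℝ) * ∑ i,
      (Real.sigmoid (s i * t i) * (1 - Real.sigmoid (s i * t i)) * (s i * t i)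
        + (Real.sigmoid (s i * t i) - y i)) * (inner ℝ (a i) h * inner ℝ (b i) k)|
        ≤ m * (‖h‖ * ‖k‖))
    (hnoise : ‖(1 / (n : ℝ)) • ∑ i, ((Real.sigmoid (s i * t i) - y i) * s i) • a i‖ ≤ ε)
    (hm : 0 ≤ m) (hR : R ≤ 1) (hh : ‖h‖ ≤ R) (hk : ‖k‖ ≤ R) (hη : 0 ≤ η)
    (hη1 : η * (K ^ 4) ^ 2 ≤ lam) (hη2 : η * lam ≤ 2)
    (hacon : acon + m + 13 * K ^ 6 * R ≤ lam / 2) :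
    ‖h - η • blockGrad s t y a b h k‖ ≤ (1 - η * acon) * R + η * ε := by
  have hK0 : 0 ≤ K := by linarith
  have hR0 : 0 ≤ R := (norm_nonneg _).trans hh
  set d : Fin n → ℝ := fun i => Real.sigmoid (s i * t i) * (1 - Real.sigmoid (s i * t i)) with hd
  have hd0 : ∀ i, |d i| ≤ 1 := fun i => by
    rw [abs_of_nonneg (Real.sigmoid_mul_one_sub_nonneg _)]
    exact Real.sigmoid_mul_one_sub_le_one _
  set N : E := (1 / (n : ℝ)) • ∑ i, ((Real.sigmoid (s i * t i) - y i) * s i) • a i with hN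
  set A : E := (1 / (n : ℝ)) • ∑ i, (d i * s i ^ 2 * inner ℝ (a i) h) • a i with hA
  set B : E := (1 / (n : ℝ)) • ∑ i,
    ((d i * (s i * t i) + (Real.sigmoid (s i * t i) - y i)) * inner ℝ (b i) k) • a i with hB
  set Q : E := blockGrad s t y a b h k - (N + A + B) with hQ
  have hinner : ∀ i, |inner ℝ (a i) h| ≤ K * R := fun i =>
    (abs_real_inner_le_norm _ _).trans (mul_le_mul (ha i) hh (norm_nonneg _) hK0)
  have hinner' : ∀ i, |inner ℝ (b i) k| ≤ K * R := fun i =>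
    (abs_real_inner_le_norm _ _).trans (mul_le_mul (hb i) hk (norm_nonneg _) hK0)
  have hQn : ‖Q‖ ≤ 13 * K ^ 6 * R ^ 2 := by
    rw [hQ, blockGrad, hN, hA, hB, ← smul_add, ← smul_add, ← smul_sub, ← Finset.sum_add_distrib,
      ← Finset.sum_add_distrib, ← Finset.sum_sub_distrib]
    refine norm_average_le hn fun i => ?_
    rw [← add_smul, ← add_smul, ← sub_smul, norm_smul, Real.norm_eq_abs]
    have := abs_blockGrad_remainder_le (y := y i) hK hR (hs i) (ht i) (hinner' i) (hinner i)
    calc _ ≤ 13 * K ^ 5 * R ^ 2 * K := mul_le_mul this (ha i) (norm_nonneg _) (by positivity)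
      _ = _ := by ring
  have hBn : ‖B‖ ≤ m * ‖k‖ := by
    have h1 := hcross B k
    have h2 : inner ℝ B B = 1 / (n : ℝ) * ∑ i,
        (d i * (s i * t i) + (Real.sigmoid (s i * t i) - y i))
          * (inner ℝ (a i) B * inner ℝ (b i) k) := by
      conv_lhs => arg 2; rw [hB]
      rw [inner_smul_left, sum_inner]
      simp only [inner_smul_left, conj_trivial]
      congr 1
      refine Finset.sum_congr rfl fun i _ => ?_
      ring
    have h3 := (le_abs_self _).trans h1
    rw [← h2, real_inner_self_eq_norm_sq] at h3
    rcases (norm_nonneg B).eq_or_lt with h0 | h0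
    · rw [← h0]; positivity
    · nlinarith
  have hAh : ‖h - η • A‖ ≤ (1 - η * lam / 2) * ‖h‖ := by
    refine norm_sub_smul_le_of_inner_ge (Λ := K ^ 4) hη ?_ ?_ hη1 hη2
    · refine (hcoer h).trans (le_of_eq ?_)
      rw [hA, inner_smul_right, inner_sum]
      simp only [inner_smul_right]
      congr 1
      refine Finset.sum_congr rfl fun i _ => ?_
      rw [real_inner_comm h (a i)]
      ring
    · refine norm_average_le hn fun i => ?_
      rw [norm_smul, Real.norm_eq_abs, abs_mul, abs_mul, abs_pow]
      have h1 : |inner ℝ (a i) h| ≤ K * ‖h‖ :=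
        (abs_real_inner_le_norm _ _).trans (mul_le_mul_of_nonneg_right (ha i) (norm_nonneg _))
      calc _ ≤ 1 * K ^ 2 * (K * ‖h‖) * K := by
            gcongr
            · exact hd0 i
            · exact hs i
            · exact ha i
        _ = _ := by ring
  have e : h - η • blockGrad s t y a b h k = (h - η • A) - η • B - η • N - η • Q := by
    rw [hQ]; module
  rw [e]
  have hsm : ∀ v : E, ‖η • v‖ = η * ‖v‖ := fun v => by rw [norm_smul, Real.norm_of_nonneg hη]
  have t1 := norm_sub_le ((h - η • A) - η • B - η • N) (η • Q)
  have t2 := norm_sub_le ((h - η • A) - η • B) (η • N)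
  have t3 := norm_sub_le (h - η • A) (η • B)
  rw [hsm] at t1 t2 t3
  have b1 : (1 - η * lam / 2) * ‖h‖ ≤ (1 - η * lam / 2) * R :=
    mul_le_mul_of_nonneg_left hh (by linarith)
  have b2 : η * ‖B‖ ≤ η * (m * R) :=
    mul_le_mul_of_nonneg_left (hBn.trans (mul_le_mul_of_nonneg_left hk hm)) hη
  have b3 : η * ‖N‖ ≤ η * ε := mul_le_mul_of_nonneg_left hnoise hη
  have b4 : η * ‖Q‖ ≤ η * (13 * K ^ 6 * R ^ 2) := mul_le_mul_of_nonneg_left hQn hη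
  have b5 : η * R * (acon + m + 13 * K ^ 6 * R) ≤ η * R * (lam / 2) :=
    mul_le_mul_of_nonneg_left hacon (by positivity)
  nlinarith

end BlockUpdate

/-! ### Alternating iterations -/

/-- Alternating iterations whose blocks contract at the rates `1 - ηᵢ a`, up to noise, as long as
both blocks are within `r`, contract in the maximum of the two block norms. The two rates may
differ, which would spoil a contraction in the Euclidean norm of the pair. -/
theorem norm_le_of_alternating_contraction {E E' : Type*} [NormedAddCommGroup E]
    [NormedAddCommGroup E'] {x : ℕ → E} {w : ℕ → E'} {a ε r E₀ η₁ η₂ : ℝ}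
    (ha : 0 < a) (hε : 0 ≤ ε) (hη₁ : 0 ≤ η₁) (hη₂ : 0 ≤ η₂) (h₁ : η₁ * a ≤ 1)
    (hx0 : ‖x 0‖ ≤ E₀) (hw0 : ‖w 0‖ ≤ E₀) (hE₀ : E₀ + ε / a ≤ r)
    (hx : ∀ t, ∀ R ≤ r, ‖x t‖ ≤ R → ‖w t‖ ≤ R → ‖x (t + 1)‖ ≤ (1 - η₁ * a) * R + η₁ * ε)
    (hw : ∀ t, ∀ R ≤ r, ‖x (t + 1)‖ ≤ R → ‖w t‖ ≤ R →
      ‖w (t + 1)‖ ≤ (1 - η₂ * a) * R + η₂ * ε) (t : ℕ) :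
    ‖x t‖ ≤ (1 - a * min η₁ η₂) ^ t * E₀ + ε / a ∧
      ‖w t‖ ≤ (1 - a * min η₁ η₂) ^ t * E₀ + ε / a := by
  set κ := 1 - a * min η₁ η₂ with hκ
  have hE0 : 0 ≤ E₀ := (norm_nonneg _).trans hx0
  have hκ1 : 1 - η₁ * a ≤ κ := by rw [hκ]; nlinarith [min_le_left η₁ η₂]
  have hκ2 : 1 - η₂ * a ≤ κ := by rw [hκ]; nlinarith [min_le_right η₁ η₂]
  have hκ0 : 0 ≤ κ := by linarith
  have hκle : κ ≤ 1 := by rw [hκ]; nlinarith [le_min hη₁ hη₂]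
  have hεa : 0 ≤ ε / a := by positivity
  induction t with
  | zero => constructor <;> simp <;> linarith
  | succ t ih =>
    have hR : κ ^ t * E₀ + ε / a ≤ r := by
      have : κ ^ t * E₀ ≤ 1 * E₀ := by gcongr; exact pow_le_one₀ hκ0 hκle
      linarith
    have step : ∀ η, 1 - η * a ≤ κ → (1 - η * a) * (κ ^ t * E₀ + ε / a) + η * ε
        ≤ κ ^ (t + 1) * E₀ + ε / a := by
      intro η hη
      have e1 : (1 - η * a) * (κ ^ t * E₀ + ε / a) + η * ε
          = (1 - η * a) * (κ ^ t * E₀) + ε / a := by field_simp; ring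
      have e2 : (1 - η * a) * (κ ^ t * E₀) ≤ κ * (κ ^ t * E₀) := by gcongr
      rw [e1, pow_succ]; linarith
    have hx' := (hx t _ hR ih.1 ih.2).trans (step η₁ hκ1)
    have hdec : κ ^ (t + 1) * E₀ + ε / a ≤ κ ^ t * E₀ + ε / a := by
      gcongr ?_ * _ + _
      exact pow_le_pow_of_le_one hκ0 hκle (Nat.le_succ t)
    exact ⟨hx', (hw t _ hR (hx'.trans hdec) ih.2).trans (step η₂ hκ2)⟩


/-- Squaring the bound `κ ^ T E₀ + e` costs half of the geometric decay, and nothing at `T = 0`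
provided the square at time `0` is bounded directly. -/
theorem sq_add_le_of_pow {κ E₀ e X : ℝ} {T : ℕ} (hκ : κ ∈ Ioo (0 : ℝ) 1) (hX : 0 ≤ X)
    (hX0 : T = 0 → X ≤ E₀) (hXT : X ≤ κ ^ T * E₀ + e) :
    X ^ 2 ≤ κ ^ T * E₀ ^ 2 + e ^ 2 / (1 - κ) := by
  obtain ⟨hκ0, hκ1⟩ := hκ
  have h1κ : 0 < 1 - κ := by linarith
  rcases Nat.eq_zero_or_pos T with rfl | hT
  · have := pow_le_pow_left₀ hX (hX0 rfl) 2
    have h2 : 0 ≤ e ^ 2 / (1 - κ) := by positivity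
    simp; linarith
  · have h1 : X ^ 2 ≤ (κ ^ T * E₀ + e) ^ 2 := pow_le_pow_left₀ hX hXT 2
    -- Young's inequality with weight `κ`: `(p + e)² ≤ p² / κ + e² / (1 - κ)`.
    have h2 : (κ ^ T * E₀ + e) ^ 2 ≤ (κ ^ T * E₀) ^ 2 / κ + e ^ 2 / (1 - κ) := by
      rw [div_add_div _ _ hκ0.ne' h1κ.ne', le_div_iff₀ (by positivity)]
      nlinarith [sq_nonneg ((1 - κ) * (κ ^ T * E₀) - κ * e)]
    have h3 : (κ ^ T * E₀) ^ 2 / κ ≤ κ ^ T * E₀ ^ 2 := by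
      rw [div_le_iff₀ hκ0]
      have h4 : κ ^ T ≤ κ := by
        simpa using pow_le_pow_of_le_one hκ0.le hκ1.le hT
      have h5 : 0 ≤ κ ^ T * E₀ ^ 2 := by positivity
      nlinarith
    linarith

/-! ### Gradients of the negative log-likelihood -/

theorem Real.hasDerivAt_log_sigmoid_likelihood (y v : ℝ) :
    HasDerivAt (fun v => y * Real.log (Real.sigmoid v) + (1 - y) * Real.log (1 - Real.sigmoid v))
      (y - Real.sigmoid v) v := by
  have h0 := (Real.sigmoid_pos v).ne'
  have h1 : 1 - Real.sigmoid v ≠ 0 := (sub_pos.2 (Real.sigmoid_lt_one v)).ne'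
  have hs := Real.hasDerivAt_sigmoid v
  refine (((hs.log h0).const_mul y).fun_add
    (((hs.const_sub 1).log h1).const_mul (1 - y))).congr_deriv ?_
  field_simp
  ring

theorem gradient_logistic_loss_affine {E : Type*} [NormedAddCommGroup E] [InnerProductSpace ℝ E]
    [CompleteSpace E] {n : ℕ} (α β y : Fin n → ℝ) (a : Fin n → E) (h : E) :
    gradient (fun h => -(1 / (n : ℝ)) * ∑ i,
      (y i * Real.log (Real.sigmoid (α i * (β i + inner ℝ (a i) h)))
        + (1 - y i) * Real.log (1 - Real.sigmoid (α i * (β i + inner ℝ (a i) h))))) h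
      = (1 / (n : ℝ)) • ∑ i,
        ((Real.sigmoid (α i * (β i + inner ℝ (a i) h)) - y i) * α i) • a i := by
  apply HasGradientAt.gradient
  rw [hasGradientAt_iff_hasFDerivAt]
  have hv : ∀ i, HasFDerivAt (fun h : E => α i * (β i + inner ℝ (a i) h))
      (α i • innerSL ℝ (a i)) h := fun i =>
    (((innerSL ℝ (a i)).hasFDerivAt (x := h)).const_add (β i)).const_mul (α i)
  have hsum := (HasFDerivAt.fun_sum (u := Finset.univ) fun i _ =>
    (Real.hasDerivAt_log_sigmoid_likelihood (y i) (α i * (β i + inner ℝ (a i) h))).comp_hasFDerivAt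
      h (hv i)).const_mul (-(1 / (n : ℝ)))
  refine hsum.congr_fderiv ?_
  ext w
  simp only [InnerProductSpace.toDual_apply_apply, inner_smul_left, sum_inner, conj_trivial,
    smul_apply, sum_apply, smul_eq_mul, innerSL_apply_apply,
    neg_mul, Finset.mul_sum]
  refine Finset.sum_congr rfl fun i _ => ?_
  ring

theorem EuclideanSpace.norm_le_sqrt_card_mul {d : ℕ} {v : Vec d} {C : ℝ} (hC : 0 ≤ C)
    (h : ∀ j, |v j| ≤ C) : ‖v‖ ≤ Real.sqrt d * C := by
  rw [EuclideanSpace.norm_eq, Real.sqrt_le_left (by positivity), mul_pow,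
    Real.sq_sqrt (by positivity)]
  calc ∑ i, ‖v i‖ ^ 2 ≤ ∑ _i : Fin d, C ^ 2 :=
        Finset.sum_le_sum fun i _ => pow_le_pow_left₀ (norm_nonneg _) (h i) 2
    _ = _ := by simp

namespace FeatureMaps

variable {𝒳 𝒮 𝒜 : Type*} [MeasurableSpace 𝒳] [MeasurableSpace 𝒮] [MeasurableSpace 𝒜]
  {d₁ d₂ : ℕ} (F : FeatureMaps 𝒳 𝒮 𝒜 d₁ d₂)

theorem logit_eq (θ : Vec d₁) (γ : Vec d₂) (c : Comparison 𝒳 𝒮 𝒜) :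
    F.logit θ γ c = F.scale γ c.1 * inner ℝ θ (F.featureDiff c) := by
  simp [logit, reward, featureDiff, inner_sub_right]

theorem scale_eq_add (γ γs : Vec d₂) (x : 𝒳) :
    F.scale γ x = F.scale γs x + inner ℝ (F.ψ x) (γ - γs) := by
  simp only [scale, inner_sub_right, real_inner_comm (F.ψ x)]
  ring

theorem inner_featureDiff_eq_add (θ θs : Vec d₁) (c : Comparison 𝒳 𝒮 𝒜) :
    (inner ℝ (F.featureDiff c) θ : ℝ)
      = inner ℝ θs (F.featureDiff c) + inner ℝ (F.featureDiff c) (θ - θs) := by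
  rw [inner_sub_right, real_inner_comm θs, add_sub_cancel]

theorem gradient_negLogLik_reward {n : ℕ} (c : Fin n → Comparison 𝒳 𝒮 𝒜) (y : Fin n → ℝ)
    (θ θs : Vec d₁) (γ γs : Vec d₂) :
    gradient (fun θ => F.negLogLik c y θ γ) θ
      = blockGrad (fun i => F.scale γs (c i).1) (fun i => inner ℝ θs (F.featureDiff (c i))) y
        (fun i => F.featureDiff (c i)) (fun i => F.ψ (c i).1) (θ - θs) (γ - γs) := by
  have key : ∀ i θ, F.logit θ γ (c i)
      = F.scale γ (c i).1 * (0 + inner ℝ (F.featureDiff (c i)) θ) := fun i θ => by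
    rw [logit_eq, zero_add, real_inner_comm]
  simp only [negLogLik, key]
  rw [gradient_logistic_loss_affine, blockGrad]
  simp only [← F.scale_eq_add γ γs, ← F.inner_featureDiff_eq_add θ θs, zero_add]

theorem gradient_negLogLik_scale {n : ℕ} (c : Fin n → Comparison 𝒳 𝒮 𝒜) (y : Fin n → ℝ)
    (θ θs : Vec d₁) (γ γs : Vec d₂) :
    gradient (fun γ => F.negLogLik c y θ γ) γ
      = blockGrad (fun i => inner ℝ θs (F.featureDiff (c i))) (fun i => F.scale γs (c i).1) y
        (fun i => F.ψ (c i).1) (fun i => F.featureDiff (c i)) (γ - γs) (θ - θs) := by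
  have key : ∀ i γ, F.logit θ γ (c i)
      = inner ℝ (F.featureDiff (c i)) θ * (F.ψ₀ (c i).1 + inner ℝ (F.ψ (c i).1) γ) := fun i γ => by
    rw [logit_eq, mul_comm, real_inner_comm, scale, real_inner_comm γ]
  have hsc : ∀ i, F.ψ₀ (c i).1 + inner ℝ (F.ψ (c i).1) γ = F.scale γ (c i).1 := fun i => by
    rw [scale, real_inner_comm γ]
  simp only [negLogLik, key]
  rw [gradient_logistic_loss_affine, blockGrad]
  simp only [← F.scale_eq_add γ γs, ← F.inner_featureDiff_eq_add θ θs, hsc]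

/-! ### Bounds at the true parameter -/

theorem norm_featureDiff_le {θs : Vec d₁} {φmax θmax : ℝ} (h : F.BoundedReward θs φmax θmax)
    (c : Comparison 𝒳 𝒮 𝒜) : ‖F.featureDiff c‖ ≤ 2 * φmax := by
  rw [featureDiff]
  linarith [norm_sub_le (F.φ c.2.1 c.2.2.2) (F.φ c.2.1 c.2.2.1), h.feature_bound c.2.1 c.2.2.2,
    h.feature_bound c.2.1 c.2.2.1]

theorem abs_inner_featureDiff_le {θs : Vec d₁} {φmax θmax : ℝ} (hθ : 0 < θmax)
    (h : F.BoundedReward θs φmax θmax) (c : Comparison 𝒳 𝒮 𝒜) :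
    |inner ℝ θs (F.featureDiff c)| ≤ Real.sqrt d₁ * θmax * (2 * φmax) :=
  (abs_real_inner_le_norm _ _).trans (mul_le_mul
    (EuclideanSpace.norm_le_sqrt_card_mul hθ.le h.param_bound) (F.norm_featureDiff_le h c)
    (norm_nonneg _) (by positivity))

theorem norm_scaleFeature_le {γs : Vec d₂} {ψmax γmax : ℝ} (h : F.BoundedScale γs ψmax γmax)
    (x : 𝒳) : ‖F.ψ x‖ ≤ ψmax := by
  refine le_trans (Real.le_sqrt_of_sq_le ?_) (h.feature_bound x)
  nlinarith [sq_nonneg (F.ψ₀ x)]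

/-- Cauchy–Schwarz for `σ_γ(x) = ⟪(1, γ), (ψ₀(x), ψ(x))⟫`. -/
theorem abs_scale_le {γs : Vec d₂} {ψmax γmax : ℝ} (h : F.BoundedScale γs ψmax γmax)
    (x : 𝒳) : |F.scale γs x| ≤ Real.sqrt (d₂ + 1) * γmax * ψmax := by
  have hγ : 0 ≤ γmax := by linarith [h.one_le]
  have h1 : ‖γs‖ ^ 2 ≤ d₂ * γmax ^ 2 := by
    have := pow_le_pow_left₀ (norm_nonneg _)
      (EuclideanSpace.norm_le_sqrt_card_mul hγ h.param_bound) 2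
    rwa [mul_pow, Real.sq_sqrt (by positivity)] at this
  have h2 : F.ψ₀ x ^ 2 + ‖F.ψ x‖ ^ 2 ≤ ψmax ^ 2 := by
    have := pow_le_pow_left₀ (Real.sqrt_nonneg _) (h.feature_bound x) 2
    rwa [Real.sq_sqrt (by positivity)] at this
  have hψ : 0 ≤ ψmax := (Real.sqrt_nonneg _).trans (h.feature_bound x)
  apply abs_le_of_sq_le_sq _ (by positivity)
  have h3 : (inner ℝ γs (F.ψ x) : ℝ) ^ 2 ≤ ‖γs‖ ^ 2 * ‖F.ψ x‖ ^ 2 := by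
    rw [← mul_pow, ← sq_abs]
    exact pow_le_pow_left₀ (abs_nonneg _) (abs_real_inner_le_norm _ _) 2
  set q : ℝ := inner ℝ γs (F.ψ x) with hq
  have h4 : (F.ψ₀ x + q) ^ 2 ≤ (1 + ‖γs‖ ^ 2) * (F.ψ₀ x ^ 2 + ‖F.ψ x‖ ^ 2) := by
    have h5 : |q| ≤ ‖γs‖ * ‖F.ψ x‖ := abs_real_inner_le_norm _ _
    have h6 : F.ψ₀ x * q ≤ |F.ψ₀ x| * (‖γs‖ * ‖F.ψ x‖) := by
      refine (le_abs_self _).trans ?_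
      rw [abs_mul]; gcongr
    nlinarith [sq_nonneg (‖γs‖ * |F.ψ₀ x| - ‖F.ψ x‖), sq_abs (F.ψ₀ x)]
  rw [scale, mul_pow, mul_pow, Real.sq_sqrt (by positivity)]
  calc _ ≤ _ := h4
    _ ≤ (γmax ^ 2 + d₂ * γmax ^ 2) * ψmax ^ 2 := by
        gcongr
        nlinarith [h.one_le]
    _ = _ := by ring

end FeatureMaps

/-- The logit at the true parameter stays within `C_max`. -/
theorem two_mul_le_logitBound (d₁ d₂ : ℕ) {φmax θmax ψmax γmax lamφ lamψ : ℝ}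
    (hφ : 0 < φmax) (hθ : 0 < θmax) (hψ : 0 < ψmax) (hγ : 0 < γmax)
    (hlφ : 0 < lamφ) (hlψ : 0 < lamψ) :
    (Real.sqrt (d₂ + 1) * γmax * ψmax) * (Real.sqrt d₁ * θmax * (2 * φmax))
      ≤ logitBound d₁ d₂ φmax θmax ψmax γmax lamφ lamψ := by
  have hb : 0 ≤ bTilde d₁ d₂ φmax θmax ψmax γmax lamφ lamψ := by
    rw [bTilde]
    have : 0 ≤ min (lamφ / (Real.sqrt d₂ * γmax)) (lamψ / (Real.sqrt d₁ * θmax)) :=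
      le_min (by positivity) (by positivity)
    positivity
  rw [logitBound, Real.sqrt_mul (by positivity)]
  have h2 : Real.sqrt 2 * Real.sqrt 2 = 2 := Real.mul_self_sqrt (by norm_num)
  calc _ = (Real.sqrt 2 * γmax) * (Real.sqrt 2 * θmax) * (Real.sqrt d₁ * Real.sqrt (d₂ + 1))
        * φmax * ψmax := by
          linear_combination -(Real.sqrt (d₂ + 1) * γmax * ψmax * (Real.sqrt d₁ * θmax * φmax)) * h2
    _ ≤ _ := by
      gcongr <;> linarith

/-! ### Hoeffding's inequality for empirical means -/

section Concentration

variable {Ω : Type*} [MeasurableSpace Ω] {P : Measure Ω} [IsProbabilityMeasure P] {n : ℕ}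

/-- One-sided Hoeffding inequality for the empirical mean. -/
theorem measure_mean_sub_ge_le (hn : 0 < n) {X : Fin n → Ω → ℝ} {K m t : ℝ}
    (hX : ∀ i, Measurable (X i)) (hind : iIndepFun X P) (hK : ∀ i ω, |X i ω| ≤ K)
    (hm : ∀ i, ∫ ω, X i ω ∂P = m) (ht : 0 ≤ t) :
    P.real {ω | t ≤ 1 / (n : ℝ) * ∑ i, X i ω - m} ≤ Real.exp (-(n * t ^ 2 / (2 * K ^ 2))) := by
  have hn' : (0 : ℝ) < n := by exact_mod_cast hn
  have hsub : ∀ i ∈ Finset.univ, HasSubgaussianMGF (fun ω => X i ω - m)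
      ((‖K - -K‖₊ / 2) ^ 2) P := fun i _ => by
    have := hasSubgaussianMGF_of_mem_Icc (μ := P) (hX i).aemeasurable
      (Filter.Eventually.of_forall fun ω => abs_le.1 (hK i ω))
    rwa [hm i] at this
  have hind' : iIndepFun (fun i ω => X i ω - m) P :=
    hind.comp (fun _ x => x - m) fun _ => measurable_id.sub_const m
  have h := HasSubgaussianMGF.measure_sum_ge_le_of_iIndepFun hind' hsub
    (ε := n * t) (by positivity)
  have hset : {ω | t ≤ 1 / (n : ℝ) * ∑ i, X i ω - m} = {ω | n * t ≤ ∑ i, (X i ω - m)} := by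
    ext ω
    simp only [mem_ofPred_eq, Finset.sum_sub_distrib, Finset.sum_const, Finset.card_univ,
      Fintype.card_fin, nsmul_eq_mul]
    have e : ∑ i, X i ω - n * m = n * (1 / (n : ℝ) * ∑ i, X i ω - m) := by field_simp
    rw [e, mul_le_mul_iff_right₀ hn']
  rw [hset]
  refine h.trans (le_of_eq ?_)
  congr 1
  have hc : (((‖K - -K‖₊ / 2) ^ 2 : NNReal) : ℝ) = K ^ 2 := by
    have : ‖K - -K‖ = 2 * |K| := by rw [sub_neg_eq_add, ← two_mul, norm_mul]; simp
    push_cast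
    rw [this, mul_div_cancel_left₀ _ two_ne_zero, sq_abs]
  push_cast at hc ⊢
  simp only [Finset.sum_const, Finset.card_univ, Fintype.card_fin, nsmul_eq_mul]
  rw [hc]
  rcases eq_or_ne K 0 with rfl | hK0
  · simp
  · field_simp

/-- Hoeffding's inequality for the empirical means of finitely many bounded functions of i.i.d.
data, with a union bound. -/
theorem measure_exists_abs_mean_sub_ge_le (hn : 0 < n) {ι : Type*} [Fintype ι]
    {X : ι → Fin n → Ω → ℝ} {m : ι → ℝ} {K t : ℝ}
    (hX : ∀ j i, Measurable (X j i)) (hind : ∀ j, iIndepFun (X j) P)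
    (hK : ∀ j i ω, |X j i ω| ≤ K) (hm : ∀ j i, ∫ ω, X j i ω ∂P = m j) (ht : 0 ≤ t) :
    P.real {ω | ∃ j, t ≤ |1 / (n : ℝ) * ∑ i, X j i ω - m j|}
      ≤ Fintype.card ι * (2 * Real.exp (-(n * t ^ 2 / (2 * K ^ 2)))) := by
  have hone : ∀ j, P.real {ω | t ≤ |1 / (n : ℝ) * ∑ i, X j i ω - m j|}
      ≤ 2 * Real.exp (-(n * t ^ 2 / (2 * K ^ 2))) := fun j => by
    have h1 := measure_mean_sub_ge_le hn (hX j) (hind j) (hK j) (hm j) ht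
    have h2 := measure_mean_sub_ge_le (P := P) (X := fun i ω => -X j i ω) (m := -m j) (K := K) hn
      (fun i => (hX j i).neg) ((hind j).comp (fun _ x => -x) fun _ => measurable_neg)
      (fun i ω => by rw [abs_neg]; exact hK j i ω) (fun i => by rw [integral_neg, hm]) ht
    have hsub : {ω | t ≤ |1 / (n : ℝ) * ∑ i, X j i ω - m j|}
        ⊆ {ω | t ≤ 1 / (n : ℝ) * ∑ i, X j i ω - m j}
          ∪ {ω | t ≤ 1 / (n : ℝ) * ∑ i, -X j i ω - -m j} := by
      intro ω hω
      rcases le_abs.1 (show t ≤ |1 / (n : ℝ) * ∑ i, X j i ω - m j| from hω) with h | h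
      · exact Or.inl h
      · refine Or.inr ?_
        simp only [mem_ofPred_eq, Finset.sum_neg_distrib]
        linarith
    calc _ ≤ _ := measureReal_mono hsub
      _ ≤ _ := measureReal_union_le _ _
      _ ≤ _ := by linarith
  rw [ofPred_exists]
  calc _ ≤ ∑ j, P.real {ω | t ≤ |1 / (n : ℝ) * ∑ i, X j i ω - m j|} :=
        measureReal_iUnion_fintype_le _
    _ ≤ ∑ _j : ι, 2 * Real.exp (-(n * t ^ 2 / (2 * K ^ 2))) := Finset.sum_le_sum fun j _ => hone j
    _ = _ := by simp

end Concentration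

/-! ### Bilinear forms of empirical and population designs -/

section BilinearForms

theorem EuclideanSpace.real_inner_eq_sum {d : ℕ} (a h : Vec d) :
    (inner ℝ a h : ℝ) = ∑ j, h j * a j := by
  simp [PiLp.inner_apply]

/-- Expansion in coordinates of an averaged product of two linear forms: entrywise closeness to
the coefficients `W` gives closeness of the bilinear forms. -/
theorem abs_average_bilinear_sub_le {d e n : ℕ} (w : Fin n → ℝ) (a : Fin n → Vec d)
    (b : Fin n → Vec e) (W : Fin d → Fin e → ℝ) {τ : ℝ}
    (hW : ∀ j l, |1 / (n : ℝ) * ∑ i, w i * (a i j * b i l) - W j l| ≤ τ) (h : Vec d) (k : Vec e) :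
    |1 / (n : ℝ) * ∑ i, w i * (inner ℝ (a i) h * inner ℝ (b i) k)
      - ∑ j, ∑ l, h j * k l * W j l| ≤ d * e * τ * (‖h‖ * ‖k‖) := by
  have e1 : 1 / (n : ℝ) * ∑ i, w i * (inner ℝ (a i) h * inner ℝ (b i) k)
      = ∑ j, ∑ l, h j * k l * (1 / (n : ℝ) * ∑ i, w i * (a i j * b i l)) := by
    simp only [EuclideanSpace.real_inner_eq_sum, Finset.sum_mul_sum]
    simp only [Finset.mul_sum]
    rw [Finset.sum_comm]
    refine Finset.sum_congr rfl fun j _ => ?_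
    rw [Finset.sum_comm]
    refine Finset.sum_congr rfl fun l _ => Finset.sum_congr rfl fun i _ => ?_
    ring
  rw [e1]
  simp only [← Finset.sum_sub_distrib, ← mul_sub]
  have hterm : ∀ j l, |h j * k l * (1 / (n : ℝ) * ∑ i, w i * (a i j * b i l) - W j l)|
      ≤ ‖h‖ * ‖k‖ * τ := fun j l => by
    rw [abs_mul, abs_mul]
    gcongr
    · exact PiLp.norm_apply_le h j
    · exact PiLp.norm_apply_le k l
    · exact hW j l
  calc _ ≤ ∑ j : Fin d, ∑ l : Fin e, ‖h‖ * ‖k‖ * τ :=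
        (Finset.abs_sum_le_sum_abs _ _).trans (Finset.sum_le_sum fun j _ =>
          (Finset.abs_sum_le_sum_abs _ _).trans (Finset.sum_le_sum fun l _ => hterm j l))
    _ = _ := by simp; ring

variable {C : Type*} [MeasurableSpace C] {ν : Measure C} [IsProbabilityMeasure ν]

theorem sum_mul_integral_eq_integral_inner {d e : ℕ} {w : C → ℝ} {a : C → Vec d} {b : C → Vec e}
    {K₁ K₂ : ℝ} (hw : Measurable w) (ha : Measurable a) (hb : Measurable b)
    (hwK : ∀ c, |w c| ≤ K₁) (haK : ∀ c, ‖a c‖ ≤ K₂) (hbK : ∀ c, ‖b c‖ ≤ K₂)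
    (h : Vec d) (k : Vec e) :
    ∑ j, ∑ l, h j * k l * ∫ c, w c * (a c j * b c l) ∂ν
      = ∫ c, w c * (inner ℝ (a c) h * inner ℝ (b c) k) ∂ν := by
  have hint : ∀ j l, Integrable (fun c => w c * (a c j * b c l)) ν := fun j l => by
    refine Integrable.of_bound (by fun_prop) (K₁ * (K₂ * K₂)) (.of_forall fun c => ?_)
    rw [norm_mul, norm_mul]
    have h0 : 0 ≤ K₁ := (abs_nonneg _).trans (hwK c)
    have h1 : 0 ≤ K₂ := (norm_nonneg _).trans (haK c)
    gcongr
    · exact hwK c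
    · exact (PiLp.norm_apply_le _ j).trans (haK c)
    · exact (PiLp.norm_apply_le _ l).trans (hbK c)
  simp only [← integral_const_mul]
  have hint' : ∀ j l, Integrable (fun c => h j * k l * (w c * (a c j * b c l))) ν :=
    fun j l => (hint j l).const_mul _
  simp_rw [← integral_finsetSum _ fun l _ => hint' _ l]
  rw [← integral_finsetSum _ fun j _ => integrable_finsetSum _ fun l _ => hint' j l]
  congr 1
  ext c
  simp only [EuclideanSpace.real_inner_eq_sum, Finset.sum_mul_sum]
  simp only [Finset.mul_sum]
  refine Finset.sum_congr rfl fun j _ => Finset.sum_congr rfl fun l _ => ?_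
  ring

/-- The least eigenvalue of a symmetric matrix bounds its quadratic form from below. -/
theorem le_sum_mul_of_isLeast_spectrum {d : ℕ} {A : Matrix (Fin d) (Fin d) ℝ} {lam : ℝ}
    (hA : A.IsHermitian) (hlam : IsLeast (spectrum ℝ A) lam) (h : Vec d) :
    lam * ‖h‖ ^ 2 ≤ ∑ j, ∑ l, h j * h l * A j l := by
  have hB : (A - lam • (1 : Matrix (Fin d) (Fin d) ℝ)).IsHermitian :=
    hA.sub (by simp [Matrix.IsHermitian])
  have hpsd : (A - lam • (1 : Matrix (Fin d) (Fin d) ℝ)).PosSemidef := by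
    rw [hB.posSemidef_iff_eigenvalues_nonneg]
    intro i
    have hmem := hB.eigenvalues_mem_spectrum_real i
    have : hB.eigenvalues i + lam ∈ spectrum ℝ A := by
      rw [spectrum.add_mem_iff, Algebra.algebraMap_eq_smul_one, neg_add_eq_sub]
      exact hmem
    have := hlam.2 this
    simpa using this
  have h1 := hpsd.dotProduct_mulVec_nonneg h.ofLp
  have h2 : ‖h‖ ^ 2 = ∑ j, h j * h j := by
    rw [EuclideanSpace.real_norm_sq_eq]; simp [sq]
  have h3 : star h.ofLp ⬝ᵥ (A - lam • (1 : Matrix (Fin d) (Fin d) ℝ)).mulVec h.ofLp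
      = ∑ j, ∑ l, h j * h l * A j l - lam * ∑ j, h j * h j := by
    rw [Matrix.sub_mulVec, Matrix.smul_mulVec, Matrix.one_mulVec, dotProduct_sub, dotProduct_smul]
    simp only [dotProduct, Matrix.mulVec, Finset.mul_sum, star_trivial, smul_eq_mul]
    congr 1
    refine Finset.sum_congr rfl fun j _ => Finset.sum_congr rfl fun l _ => ?_
    ring
  rw [h2]
  linarith

/-- Reweighting the design `E[s² a aᵀ]` by a factor that is at least `κ` lowers its least
eigenvalue by a factor `κ` at most. -/
theorem le_sum_mul_integral_of_isLeast_spectrum {d : ℕ} {w s : C → ℝ} {a : C → Vec d}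
    {κ K lam : ℝ} (hw : Measurable w) (hs : Measurable s) (ha : Measurable a)
    (hκ : 0 ≤ κ) (hκw : ∀ c, κ ≤ w c) (hw1 : ∀ c, w c ≤ 1) (hsK : ∀ c, |s c| ≤ K)
    (haK : ∀ c, ‖a c‖ ≤ K)
    (hlam : IsLeast (spectrum ℝ (Matrix.of fun i j => ∫ c, s c ^ 2 * (a c i * a c j) ∂ν)) lam)
    (h : Vec d) :
    κ * lam * ‖h‖ ^ 2 ≤ ∑ j, ∑ l, h j * h l * ∫ c, w c * s c ^ 2 * (a c j * a c l) ∂ν := by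
  have hs2 : ∀ c, |s c ^ 2| ≤ K ^ 2 := fun c => by
    rw [abs_pow]; exact pow_le_pow_left₀ (abs_nonneg _) (hsK c) 2
  have hw0 : ∀ c, 0 ≤ w c := fun c => hκ.trans (hκw c)
  have hws : ∀ c, |w c * s c ^ 2| ≤ 1 * K ^ 2 := fun c => by
    rw [abs_mul, abs_of_nonneg (hw0 c)]
    exact mul_le_mul (hw1 c) (hs2 c) (abs_nonneg _) zero_le_one
  have hsym : (Matrix.of fun i j => ∫ c, s c ^ 2 * (a c i * a c j) ∂ν).IsHermitian := by
    ext i j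
    simp [mul_comm (a _ i)]
  have h1 := le_sum_mul_of_isLeast_spectrum hsym hlam h
  simp only [Matrix.of_apply] at h1
  rw [sum_mul_integral_eq_integral_inner (hs.pow_const 2) ha ha hs2 haK haK] at h1
  rw [sum_mul_integral_eq_integral_inner (w := fun c => w c * s c ^ 2)
    (hw.mul (hs.pow_const 2)) ha ha hws haK haK]
  calc κ * lam * ‖h‖ ^ 2 ≤ κ * ∫ c, s c ^ 2 * (inner ℝ (a c) h * inner ℝ (a c) h) ∂ν := by
        rw [mul_assoc]; gcongr
    _ = ∫ c, κ * (s c ^ 2 * (inner ℝ (a c) h * inner ℝ (a c) h)) ∂ν :=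
        (integral_const_mul _ _).symm
    _ ≤ _ := by
        have hin : Measurable fun c => (inner ℝ (a c) h : ℝ) := by fun_prop
        have hbd : ∀ c, |(inner ℝ (a c) h : ℝ)| ≤ K * ‖h‖ := fun c =>
          (abs_real_inner_le_norm _ _).trans (mul_le_mul_of_nonneg_right (haK c) (norm_nonneg _))
        have hint : ∀ v : C → ℝ, Measurable v → (∀ c, |v c| ≤ 1 * K ^ 2) →
            Integrable (fun c => v c * (inner ℝ (a c) h * inner ℝ (a c) h)) ν := fun v hv hvK => by
          refine Integrable.of_bound (by fun_prop) (1 * K ^ 2 * (K * ‖h‖ * (K * ‖h‖)))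
            (.of_forall fun c => ?_)
          rw [norm_mul, norm_mul]
          have hK0 : 0 ≤ K := (norm_nonneg _).trans (haK c)
          gcongr
          · exact hvK c
          · exact hbd c
          · exact hbd c
        refine integral_mono ((hint _ (hs.pow_const 2) (by simpa using hs2)).const_mul κ)
          (hint _ (hw.mul (hs.pow_const 2)) hws) fun c => ?_
        simp only
        rw [← mul_assoc]
        gcongr
        · exact mul_self_nonneg _
        · exact hκw c

open scoped Matrix.Norms.L2Operator in
theorem abs_sum_mul_le_l2_opNorm {d e : ℕ} (B : Matrix (Fin e) (Fin d) ℝ) (h : Vec d)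
    (k : Vec e) : |∑ j, ∑ l, h j * k l * B l j| ≤ ‖B‖ * (‖h‖ * ‖k‖) := by
  have h1 := Matrix.l2_opNorm_mulVec B h
  set v : Vec e := (EuclideanSpace.equiv (Fin e) ℝ).symm (B.mulVec h.ofLp) with hv
  have h2 : ∑ j, ∑ l, h j * k l * B l j = inner ℝ v k := by
    rw [Finset.sum_comm]
    simp only [EuclideanSpace.real_inner_eq_sum, hv]
    refine Finset.sum_congr rfl fun l _ => ?_
    simp [Matrix.mulVec, dotProduct, Finset.mul_sum]
    refine Finset.sum_congr rfl fun j _ => ?_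
    ring
  rw [h2]
  calc _ ≤ ‖v‖ * ‖k‖ := abs_real_inner_le_norm _ _
    _ ≤ ‖B‖ * ‖h‖ * ‖k‖ := by gcongr
    _ = _ := by ring

end BilinearForms

/-! ### Concentration of the Hessian and of the gradient noise -/

section EmpiricalForms

variable {Ω : Type*} [MeasurableSpace Ω] {P : Measure Ω} [IsProbabilityMeasure P] {n : ℕ}
  {C : Type*} [MeasurableSpace C] {ν : Measure C} [IsProbabilityMeasure ν]

/-- With high probability the empirical, reweighted design is almost as coercive as the
population design. -/
theorem measure_not_coercive_le (hn : 0 < n) {d : ℕ} {X : Fin n → Ω → C} {w s : C → ℝ}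
    {a : C → Vec d} {κ K lam τ : ℝ} (hX : ∀ i, Measurable (X i)) (hind : iIndepFun X P)
    (hlaw : ∀ i, P.map (X i) = ν)
    (hw : Measurable w) (hs : Measurable s) (ha : Measurable a)
    (hκ : 0 ≤ κ) (hκw : ∀ c, κ ≤ w c) (hw1 : ∀ c, w c ≤ 1) (hsK : ∀ c, |s c| ≤ K)
    (haK : ∀ c, ‖a c‖ ≤ K)
    (hlam : IsLeast (spectrum ℝ (Matrix.of fun i j => ∫ c, s c ^ 2 * (a c i * a c j) ∂ν)) lam)
    (hτ : 0 ≤ τ) :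
    P.real {ω | ¬ ∀ h : Vec d, (κ * lam - d * d * τ) * ‖h‖ ^ 2 ≤ 1 / (n : ℝ) * ∑ i,
        w (X i ω) * s (X i ω) ^ 2 * (inner ℝ (a (X i ω)) h * inner ℝ (a (X i ω)) h)}
      ≤ (d * d : ℝ) * (2 * Real.exp (-(n * τ ^ 2 / (2 * (2 * K ^ 4) ^ 2)))) := by
  have hg : ∀ j : Fin d × Fin d, Measurable fun c => w c * s c ^ 2 * (a c j.1 * a c j.2) :=
    fun j => by fun_prop
  have hbound : ∀ (j : Fin d × Fin d) (i : Fin n) (ω : Ω),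
      |w (X i ω) * s (X i ω) ^ 2 * (a (X i ω) j.1 * a (X i ω) j.2)| ≤ 2 * K ^ 4 := by
    intro j i ω
    have hK0 : 0 ≤ K := (norm_nonneg _).trans (haK (X i ω))
    rw [abs_mul, abs_mul, abs_mul, abs_pow, abs_of_nonneg (hκ.trans (hκw _))]
    calc _ ≤ 1 * K ^ 2 * (K * K) := by
          gcongr
          · exact hw1 _
          · exact hsK _
          · exact (PiLp.norm_apply_le (a (X i ω)) j.1).trans (haK _)
          · exact (PiLp.norm_apply_le (a (X i ω)) j.2).trans (haK _)
      _ ≤ 2 * K ^ 4 := by nlinarith [pow_nonneg hK0 4]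
  have hconc := measure_exists_abs_mean_sub_ge_le (P := P) hn (ι := Fin d × Fin d)
    (X := fun j i ω => w (X i ω) * s (X i ω) ^ 2 * (a (X i ω) j.1 * a (X i ω) j.2))
    (m := fun j => ∫ c, w c * s c ^ 2 * (a c j.1 * a c j.2) ∂ν) (K := 2 * K ^ 4) (t := τ)
    (fun j i => (hg j).comp (hX i)) (fun j => hind.comp (fun _ => _) fun _ => hg j) hbound
    (fun j i => by
      rw [← hlaw i, integral_map (hX i).aemeasurable (hg j).aestronglyMeasurable]) hτ
  simp only [Fintype.card_prod, Fintype.card_fin, Nat.cast_mul] at hconc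
  refine (measureReal_mono ?_).trans hconc
  intro ω hω
  by_contra hcon
  refine hω fun h => ?_
  have hcl : ∀ j l, |1 / (n : ℝ) * ∑ i, w (X i ω) * s (X i ω) ^ 2 * (a (X i ω) j * a (X i ω) l)
      - ∫ c, w c * s c ^ 2 * (a c j * a c l) ∂ν| ≤ τ := fun j l => by
    simp only [mem_ofPred_eq, not_exists, not_le] at hcon
    exact (hcon (j, l)).le
  have h1 := abs_average_bilinear_sub_le (fun i => w (X i ω) * s (X i ω) ^ 2)
    (fun i => a (X i ω)) (fun i => a (X i ω)) _ hcl h h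
  have h2 := le_sum_mul_integral_of_isLeast_spectrum hw hs ha hκ hκw hw1 hsK haK hlam h
  have h3 := (abs_le.1 h1).1
  rw [← sq] at h3
  linarith

/-- With high probability the gradient noise at the truth, an average of centred vectors, is
small. -/
theorem measure_noise_gt_le (hn : 0 < n) {d : ℕ} {X : Fin n → Ω → C × ℝ} {g : C × ℝ → ℝ}
    {a : C → Vec d} {K t : ℝ} (hX : ∀ i, Measurable (X i)) (hind : iIndepFun X P)
    (hg : Measurable g) (ha : Measurable a) (hK1 : 1 ≤ K)
    (hgK : ∀ i ω, |g (X i ω)| ≤ K) (haK : ∀ c, ‖a c‖ ≤ K)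
    (hmean : ∀ i j, ∫ ω, g (X i ω) * a (X i ω).1 j ∂P = 0) (ht : 0 ≤ t) :
    P.real {ω | ¬ ‖(1 / (n : ℝ)) • ∑ i, g (X i ω) • a (X i ω).1‖ ≤ d * t}
      ≤ (d : ℝ) * (2 * Real.exp (-(n * t ^ 2 / (2 * (2 * K ^ 4) ^ 2)))) := by
  have hm : ∀ j : Fin d, Measurable fun x : C × ℝ => g x * a x.1 j := fun j => by fun_prop
  have hbound : ∀ (j : Fin d) (i : Fin n) (ω : Ω), |g (X i ω) * a (X i ω).1 j| ≤ 2 * K ^ 4 := by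
    intro j i ω
    rw [abs_mul]
    calc _ ≤ K * K := by
          gcongr
          · exact hgK _ _
          · exact (PiLp.norm_apply_le (a (X i ω).1) j).trans (haK _)
      _ = K ^ 2 := (sq K).symm
      _ ≤ K ^ 4 := pow_le_pow_right₀ hK1 (by norm_num)
      _ ≤ 2 * K ^ 4 := by linarith [pow_nonneg (zero_le_one.trans hK1) 4]
  have hconc := measure_exists_abs_mean_sub_ge_le (P := P) hn (ι := Fin d)
    (X := fun j i ω => g (X i ω) * a (X i ω).1 j) (m := fun _ => 0) (K := 2 * K ^ 4) (t := t)
    (fun j i => (hm j).comp (hX i)) (fun j => hind.comp (fun _ => _) fun _ => hm j) hbound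
    (fun j i => hmean i j) ht
  rw [Fintype.card_fin] at hconc
  refine (measureReal_mono ?_).trans hconc
  intro ω hω
  by_contra hcon
  refine hω ?_
  simp only [mem_ofPred_eq, not_exists, not_le, sub_zero] at hcon
  set v : Vec d := (1 / (n : ℝ)) • ∑ i, g (X i ω) • a (X i ω).1 with hv
  have hvj : ∀ j, |v j| ≤ t := fun j => by
    refine le_of_eq_of_le ?_ (hcon j).le
    simp [hv]
  refine (EuclideanSpace.norm_le_sqrt_card_mul ht hvj).trans ?_
  gcongr
  rw [Real.sqrt_le_left (by positivity)]
  exact_mod_cast Nat.le_self_pow two_ne_zero d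

end EmpiricalForms

namespace FeatureMaps

variable {𝒳 𝒮 𝒜 : Type*} [MeasurableSpace 𝒳] [MeasurableSpace 𝒮] [MeasurableSpace 𝒜]
  {d₁ d₂ : ℕ} (F : FeatureMaps 𝒳 𝒮 𝒜 d₁ d₂)

@[fun_prop]
theorem measurable_featureDiff : Measurable F.featureDiff :=
  (F.measurable_φ.comp (f := fun c : Comparison 𝒳 𝒮 𝒜 => (c.2.1, c.2.2.2)) (by fun_prop)).sub
    (F.measurable_φ.comp (f := fun c : Comparison 𝒳 𝒮 𝒜 => (c.2.1, c.2.2.1)) (by fun_prop))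

@[fun_prop]
theorem measurable_scale (γ : Vec d₂) :
    Measurable fun c : Comparison 𝒳 𝒮 𝒜 => F.scale γ c.1 := by
  have h1 := F.measurable_ψ₀
  have h2 := F.measurable_ψ
  unfold scale
  fun_prop

/-- The logit `u = σ_{γ_*}(x) θ_*ᵀ z` at the true parameter. -/
noncomputable def trueLogit (θs : Vec d₁) (γs : Vec d₂) (c : Comparison 𝒳 𝒮 𝒜) : ℝ :=
  F.scale γs c.1 * inner ℝ θs (F.featureDiff c)

@[fun_prop]
theorem measurable_trueLogit (θs : Vec d₁) (γs : Vec d₂) : Measurable (F.trueLogit θs γs) := by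
  unfold trueLogit
  fun_prop

theorem abs_sub_label_le_one {x y : ℝ} (hy : y = 0 ∨ y = 1) : |Real.sigmoid x - y| ≤ 1 := by
  have h0 := Real.sigmoid_nonneg x
  have h1 := Real.sigmoid_le_one x
  rw [abs_le]
  rcases hy with rfl | rfl <;> constructor <;> linarith

variable {Ω : Type*} [MeasurableSpace Ω] {P : Measure Ω} [IsProbabilityMeasure P]
  {ν : Measure (Comparison 𝒳 𝒮 𝒜)} {θs : Vec d₁} {γs : Vec d₂} {n : ℕ}
  {ctx : Fin n → Ω → Comparison 𝒳 𝒮 𝒜} {Y : Fin n → Ω → ℝ}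

/-- The residual `μ(u) - Y` is centred given the comparison, hence orthogonal to every bounded
function of it. -/
theorem integral_residual_mul_eq_zero {F : FeatureMaps 𝒳 𝒮 𝒜 d₁ d₂}
    (h : F.IsPreferenceSample P ν θs γs ctx Y) (i : Fin n)
    {g : Comparison 𝒳 𝒮 𝒜 → ℝ} (hg : Measurable g) {K : ℝ} (hgK : ∀ c, |g c| ≤ K) :
    ∫ ω, (Real.sigmoid (F.trueLogit θs γs (ctx i ω)) - Y i ω) * g (ctx i ω) ∂P = 0 := by
  have hm : MeasurableSpace.comap (ctx i) inferInstance ≤ (inferInstance : MeasurableSpace Ω) :=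
    (h.measurable_ctx i).comap_le
  have hY : Y i = (Y i ⁻¹' {1}).indicator fun _ => (1 : ℝ) := by
    ext ω
    rcases h.label_mem i ω with h0 | h0 <;> simp [indicator, h0]
  have hYint : Integrable (Y i) P :=
    Integrable.of_bound (h.measurable_label i).aestronglyMeasurable 1 (.of_forall fun ω => by
      rcases h.label_mem i ω with h0 | h0 <;> simp [h0])
  have hgm : StronglyMeasurable[MeasurableSpace.comap (ctx i) inferInstance]
      fun ω => g (ctx i ω) :=
    (hg.comp (comap_measurable (ctx i))).stronglyMeasurable
  have hpull := condExp_stronglyMeasurable_mul_of_bound hm hgm hYint K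
    (.of_forall fun ω => hgK (ctx i ω))
  have hlaw : P[Y i | MeasurableSpace.comap (ctx i) inferInstance]
      =ᵐ[P] fun ω => Real.sigmoid (F.trueLogit θs γs (ctx i ω)) := by
    have := h.label_law i
    rw [← hY] at this
    simpa only [F.logit_eq, trueLogit] using this
  have hgint : ∀ f : Ω → ℝ, Measurable f → (∀ ω, |f ω| ≤ 1) →
      Integrable (fun ω => f ω * g (ctx i ω)) P := fun f hf hf1 => by
    refine Integrable.of_bound
      (hf.mul (hg.comp (h.measurable_ctx i))).aestronglyMeasurable (1 * K) (.of_forall fun ω => ?_)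
    rw [norm_mul]
    exact mul_le_mul (hf1 ω) (hgK _) (abs_nonneg _) zero_le_one
  have e1 : ∫ ω, Y i ω * g (ctx i ω) ∂P
      = ∫ ω, Real.sigmoid (F.trueLogit θs γs (ctx i ω)) * g (ctx i ω) ∂P := by
    have hcond := integral_condExp (μ := P) (f := fun ω => g (ctx i ω) * Y i ω) hm
    have : ∫ ω, Y i ω * g (ctx i ω) ∂P = ∫ ω, g (ctx i ω) * Y i ω ∂P := by
      congr 1; ext ω; ring
    rw [this, ← hcond]
    refine integral_congr_ae ?_
    filter_upwards [hpull, hlaw] with ω h1 h2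
    refine h1.trans ?_
    simp only [Pi.mul_apply]
    rw [h2, mul_comm]
  have hsm : Measurable fun ω => Real.sigmoid (F.trueLogit θs γs (ctx i ω)) :=
    continuous_sigmoid.measurable.comp
      ((F.measurable_trueLogit θs γs).comp (h.measurable_ctx i))
  simp only [sub_mul]
  rw [integral_sub (hgint _ hsm fun ω => by
      rw [abs_of_nonneg (Real.sigmoid_nonneg _)]; exact Real.sigmoid_le_one _)
    (hgint _ (h.measurable_label i) fun ω => by
      rcases h.label_mem i ω with h0 | h0 <;> simp [h0]), e1, sub_self]

/-- With high probability the empirical coupling between the two blocks is at most the population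
coupling `M` plus a small error. The empirical cross block of the Hessian has the additional,
centred, term `(μ(u) - y) ψ zᵀ`. -/
theorem measure_not_cross_le (hn : 0 < n) {F : FeatureMaps 𝒳 𝒮 𝒜 d₁ d₂}
    (h : F.IsPreferenceSample P ν θs γs ctx Y) {K τ : ℝ} (hK1 : 1 ≤ K)
    (hsK : ∀ x, |F.scale γs x| ≤ K) (hqK : ∀ c, |inner ℝ θs (F.featureDiff c)| ≤ K)
    (hzK : ∀ c, ‖F.featureDiff c‖ ≤ K) (hψK : ∀ x, ‖F.ψ x‖ ≤ K) (hτ : 0 ≤ τ) :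
    P.real {ω | ¬ ∀ (h : Vec d₁) (k : Vec d₂), |1 / (n : ℝ) * ∑ i,
        (Real.sigmoid (F.trueLogit θs γs (ctx i ω))
            * (1 - Real.sigmoid (F.trueLogit θs γs (ctx i ω))) * F.trueLogit θs γs (ctx i ω)
          + (Real.sigmoid (F.trueLogit θs γs (ctx i ω)) - Y i ω))
          * (inner ℝ (F.featureDiff (ctx i ω)) h * inner ℝ (F.ψ (ctx i ω).1) k)|
        ≤ (F.coupling ν θs γs + d₁ * d₂ * τ) * (‖h‖ * ‖k‖)}
      ≤ (d₁ * d₂ : ℝ) * (2 * Real.exp (-(n * τ ^ 2 / (2 * (2 * K ^ 4) ^ 2)))) := by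
  set u := F.trueLogit θs γs with hu
  have hum : Measurable u := F.measurable_trueLogit θs γs
  have hσ := continuous_sigmoid.measurable
  have hψm := F.measurable_ψ
  set w : Comparison 𝒳 𝒮 𝒜 → ℝ := fun c => Real.sigmoid (u c) * (1 - Real.sigmoid (u c)) * u c
    with hw
  have hwm : Measurable w := by fun_prop
  have hK0 : 0 ≤ K := zero_le_one.trans hK1
  have huK : ∀ c, |u c| ≤ K ^ 2 := fun c => by
    rw [hu, trueLogit, abs_mul, sq]
    exact mul_le_mul (hsK _) (hqK _) (abs_nonneg _) hK0
  have hwK : ∀ c, |w c| ≤ K ^ 2 := fun c => by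
    rw [hw]
    simp only
    rw [abs_mul, abs_of_nonneg (Real.sigmoid_mul_one_sub_nonneg _)]
    calc _ ≤ 1 * K ^ 2 := mul_le_mul (Real.sigmoid_mul_one_sub_le_one _) (huK c) (abs_nonneg _)
          zero_le_one
      _ = _ := one_mul _
  have hf : ∀ j : Fin d₁ × Fin d₂, Measurable fun x : Comparison 𝒳 𝒮 𝒜 × ℝ =>
      (w x.1 + (Real.sigmoid (u x.1) - x.2)) * (F.featureDiff x.1 j.1 * F.ψ x.1.1 j.2) :=
    fun j => by fun_prop
  have hzψ : ∀ (j : Fin d₁ × Fin d₂) c, |F.featureDiff c j.1 * F.ψ c.1 j.2| ≤ K * K :=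
    fun j c => by
      rw [abs_mul]
      exact mul_le_mul ((PiLp.norm_apply_le (F.featureDiff c) j.1).trans (hzK c))
        ((PiLp.norm_apply_le (F.ψ c.1) j.2).trans (hψK _)) (abs_nonneg _) hK0
  have hbound : ∀ (j : Fin d₁ × Fin d₂) (i : Fin n) (ω : Ω),
      |(w (ctx i ω) + (Real.sigmoid (u (ctx i ω)) - Y i ω))
        * (F.featureDiff (ctx i ω) j.1 * F.ψ (ctx i ω).1 j.2)| ≤ 2 * K ^ 4 := by
    intro j i ω
    rw [abs_mul]
    have h1 := (abs_add_le _ _).trans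
      (add_le_add (hwK (ctx i ω)) (abs_sub_label_le_one (x := u (ctx i ω)) (h.label_mem i ω)))
    calc _ ≤ (K ^ 2 + 1) * (K * K) := mul_le_mul h1 (hzψ j _) (abs_nonneg _) (by positivity)
      _ ≤ 2 * K ^ 4 := by
        nlinarith [mul_nonneg (sq_nonneg K) (sub_nonneg.2 (one_le_pow₀ (n := 2) hK1))]
  have hzψm : ∀ j : Fin d₁ × Fin d₂, Measurable fun c : Comparison 𝒳 𝒮 𝒜 =>
      F.featureDiff c j.1 * F.ψ c.1 j.2 := fun j => by fun_prop
  have hmean : ∀ (j : Fin d₁ × Fin d₂) (i : Fin n),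
      ∫ ω, (w (ctx i ω) + (Real.sigmoid (u (ctx i ω)) - Y i ω))
        * (F.featureDiff (ctx i ω) j.1 * F.ψ (ctx i ω).1 j.2) ∂P
      = ∫ c, w c * (F.featureDiff c j.1 * F.ψ c.1 j.2) ∂ν := by
    intro j i
    have hres := integral_residual_mul_eq_zero h i (hzψm j) (hzψ j)
    simp only [add_mul]
    rw [integral_add, hres, add_zero, ← h.ctx_law i,
      integral_map (f := fun c => w c * (F.featureDiff c j.1 * F.ψ c.1 j.2))
        (h.measurable_ctx i).aemeasurable (hwm.mul (hzψm j)).aestronglyMeasurable]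
    · refine Integrable.of_bound ((hwm.mul (hzψm j)).comp (h.measurable_ctx i)).aestronglyMeasurable
        (K ^ 2 * (K * K)) (.of_forall fun ω => ?_)
      rw [norm_mul]
      exact mul_le_mul (hwK _) (hzψ j _) (abs_nonneg _) (by positivity)
    · refine Integrable.of_bound (((hσ.comp (hum.comp (h.measurable_ctx i))).sub
        (h.measurable_label i)).mul ((hzψm j).comp (h.measurable_ctx i))).aestronglyMeasurable
        (1 * (K * K)) (.of_forall fun ω => ?_)
      rw [norm_mul]
      exact mul_le_mul (abs_sub_label_le_one (h.label_mem i ω)) (hzψ j _) (abs_nonneg _)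
        zero_le_one
  have hconc := measure_exists_abs_mean_sub_ge_le (P := P) hn (ι := Fin d₁ × Fin d₂)
    (K := 2 * K ^ 4) (t := τ)
    (fun j i => (hf j).comp ((h.measurable_ctx i).prodMk (h.measurable_label i)))
    (fun j => h.indep.comp (fun _ => _) fun _ => hf j) hbound hmean hτ
  simp only [Fintype.card_prod, Fintype.card_fin, Nat.cast_mul, Function.comp_apply] at hconc
  refine (measureReal_mono ?_).trans hconc
  intro ω hω
  by_contra hcon
  refine hω fun hv k => ?_
  simp only [mem_ofPred_eq, not_exists, not_le] at hcon
  have h1 := abs_average_bilinear_sub_le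
    (fun i => w (ctx i ω) + (Real.sigmoid (u (ctx i ω)) - Y i ω))
    (fun i => F.featureDiff (ctx i ω)) (fun i => F.ψ (ctx i ω).1)
    (fun j l => ∫ c, w c * (F.featureDiff c j * F.ψ c.1 l) ∂ν)
    (fun j l => (hcon (j, l)).le) hv k
  have h2 := abs_sum_mul_le_l2_opNorm (F.crossMatrix ν θs γs) hv k
  have h3 : ∀ j l, F.crossMatrix ν θs γs l j = ∫ c, w c * (F.featureDiff c j * F.ψ c.1 l) ∂ν := by
    intro j l
    rw [crossMatrix, Matrix.of_apply]
    congr 1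
    ext c
    simp only [hw, hu, trueLogit]
    ring
  simp only [h3] at h2
  have h4 := abs_le.1 h1
  have h5 := abs_le.1 h2
  rw [coupling, add_mul]
  rw [abs_le]
  constructor <;> linarith [h4.1, h4.2, h5.1, h5.2]

end FeatureMaps

/-! ### Convergence on a good sample, and the probability of such a sample -/

namespace FeatureMaps

variable {𝒳 𝒮 𝒜 : Type*} [MeasurableSpace 𝒳] [MeasurableSpace 𝒮] [MeasurableSpace 𝒜]
  {d₁ d₂ : ℕ} (F : FeatureMaps 𝒳 𝒮 𝒜 d₁ d₂)

/-- The gradient noise `∇_θ L_n(θ_*, γ_*)`. -/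
noncomputable def rewardNoise (θs : Vec d₁) (γs : Vec d₂) {n : ℕ}
    (c : Fin n → Comparison 𝒳 𝒮 𝒜) (y : Fin n → ℝ) : Vec d₁ :=
  (1 / (n : ℝ)) • ∑ i,
    ((Real.sigmoid (F.trueLogit θs γs (c i)) - y i) * F.scale γs (c i).1) • F.featureDiff (c i)

/-- The gradient noise `∇_γ L_n(θ_*, γ_*)`. -/
noncomputable def scaleNoise (θs : Vec d₁) (γs : Vec d₂) {n : ℕ}
    (c : Fin n → Comparison 𝒳 𝒮 𝒜) (y : Fin n → ℝ) : Vec d₂ :=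
  (1 / (n : ℝ)) • ∑ i,
    ((Real.sigmoid (F.trueLogit θs γs (c i)) - y i) * inner ℝ θs (F.featureDiff (c i)))
      • F.ψ (c i).1

/-- The Hessian of `L_n` at the true parameter has `lam`-coercive diagonal blocks, and its
off-diagonal block has norm at most `m`. -/
structure HessianBounds (θs : Vec d₁) (γs : Vec d₂) {n : ℕ}
    (c : Fin n → Comparison 𝒳 𝒮 𝒜) (y : Fin n → ℝ) (lam m : ℝ) : Prop where
  reward : ∀ h : Vec d₁, lam * ‖h‖ ^ 2 ≤ 1 / (n : ℝ) * ∑ i,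
    Real.sigmoid (F.trueLogit θs γs (c i)) * (1 - Real.sigmoid (F.trueLogit θs γs (c i)))
      * F.scale γs (c i).1 ^ 2
      * (inner ℝ (F.featureDiff (c i)) h * inner ℝ (F.featureDiff (c i)) h)
  scale : ∀ k : Vec d₂, lam * ‖k‖ ^ 2 ≤ 1 / (n : ℝ) * ∑ i,
    Real.sigmoid (F.trueLogit θs γs (c i)) * (1 - Real.sigmoid (F.trueLogit θs γs (c i)))
      * (inner ℝ θs (F.featureDiff (c i)) : ℝ) ^ 2
      * (inner ℝ (F.ψ (c i).1) k * inner ℝ (F.ψ (c i).1) k)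
  cross : ∀ (h : Vec d₁) (k : Vec d₂), |1 / (n : ℝ) * ∑ i,
    (Real.sigmoid (F.trueLogit θs γs (c i)) * (1 - Real.sigmoid (F.trueLogit θs γs (c i)))
        * F.trueLogit θs γs (c i) + (Real.sigmoid (F.trueLogit θs γs (c i)) - y i))
      * (inner ℝ (F.featureDiff (c i)) h * inner ℝ (F.ψ (c i).1) k)| ≤ m * (‖h‖ * ‖k‖)

/-- The deterministic guarantee: on a sample whose Hessian at the truth is good and whose gradient
noise at the truth is at most `ε`, alternating gradient descent started near the truth converges
geometrically up to an error of order `ε`. -/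
theorem norm_altGD_sub_sq_add_le {θs : Vec d₁} {γs : Vec d₂} {n : ℕ} (hn : 0 < n)
    {c : Fin n → Comparison 𝒳 𝒮 𝒜} {y : Fin n → ℝ} {K lam m a r ε E₀ η₁ η₂ : ℝ} (hK1 : 1 ≤ K)
    (hsK : ∀ x, |F.scale γs x| ≤ K) (hqK : ∀ c, |inner ℝ θs (F.featureDiff c)| ≤ K)
    (hzK : ∀ c, ‖F.featureDiff c‖ ≤ K) (hψK : ∀ x, ‖F.ψ x‖ ≤ K)
    (hH : F.HessianBounds θs γs c y lam m)
    (hθ : ‖F.rewardNoise θs γs c y‖ ≤ ε) (hγ : ‖F.scaleNoise θs γs c y‖ ≤ ε)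
    (ha : 0 < a) (hm : 0 ≤ m) (hr : 0 ≤ r) (hr1 : r ≤ 1) (ham : a + m + 13 * K ^ 6 * r ≤ lam / 2)
    (hη₁ : 0 < η₁) (hη₂ : 0 < η₂) (hη₁K : η₁ * (K ^ 4) ^ 2 ≤ lam) (hη₂K : η₂ * (K ^ 4) ^ 2 ≤ lam)
    (hη₁l : η₁ * lam ≤ 2) (hη₂l : η₂ * lam ≤ 2)
    {θ₀ : Vec d₁} {γ₀ : Vec d₂} (hθ₀ : ‖θ₀ - θs‖ ≤ E₀) (hγ₀ : ‖γ₀ - γs‖ ≤ E₀)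
    (hE₀ : E₀ + ε / a ≤ r) (hκ : 1 - a * min η₁ η₂ ∈ Ioo (0 : ℝ) 1) (T : ℕ) :
    ‖(altGD (F.negLogLik c y) η₁ η₂ θ₀ γ₀ T).1 - θs‖ ^ 2
      + ‖(altGD (F.negLogLik c y) η₁ η₂ θ₀ γ₀ T).2 - γs‖ ^ 2
      ≤ (1 - a * min η₁ η₂) ^ T * (2 * E₀ ^ 2)
        + 2 * ((ε / a) ^ 2 / (1 - (1 - a * min η₁ η₂))) := by
  have hK0 : 0 ≤ K := zero_le_one.trans hK1
  set x : ℕ → Vec d₁ := fun t => (altGD (F.negLogLik c y) η₁ η₂ θ₀ γ₀ t).1 - θs with hx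
  set w : ℕ → Vec d₂ := fun t => (altGD (F.negLogLik c y) η₁ η₂ θ₀ γ₀ t).2 - γs with hw
  have hx' : ∀ t, x (t + 1) = x t - η₁ • blockGrad (fun i => F.scale γs (c i).1)
      (fun i => inner ℝ θs (F.featureDiff (c i))) y (fun i => F.featureDiff (c i))
      (fun i => F.ψ (c i).1) (x t) (w t) := fun t => by
    simp only [hx, hw, altGD]
    rw [F.gradient_negLogLik_reward c y _ θs _ γs]
    abel
  have hw' : ∀ t, w (t + 1) = w t - η₂ • blockGrad
      (fun i => inner ℝ θs (F.featureDiff (c i))) (fun i => F.scale γs (c i).1) y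
      (fun i => F.ψ (c i).1) (fun i => F.featureDiff (c i)) (w t) (x (t + 1)) := fun t => by
    simp only [hx, hw, altGD]
    rw [F.gradient_negLogLik_scale c y _ θs _ γs]
    abel
  have hrad : ∀ R ≤ r, a + m + 13 * K ^ 6 * R ≤ lam / 2 := fun R hR => by
    have : 13 * K ^ 6 * R ≤ 13 * K ^ 6 * r := by gcongr
    linarith
  have hlam : 2 * a ≤ lam := by
    have : 0 ≤ 13 * K ^ 6 * r := by positivity
    linarith
  have hε : 0 ≤ ε := (norm_nonneg _).trans hθ
  have hiter := norm_le_of_alternating_contraction (x := x) (w := w) (a := a) (ε := ε) (r := r)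
    (E₀ := E₀) (η₁ := η₁) (η₂ := η₂) ha hε hη₁.le hη₂.le (by nlinarith) hθ₀ hγ₀ hE₀
    (fun t R hR hxR hwR => by
      rw [hx']
      exact norm_sub_smul_blockGrad_le hn hK1 (fun i => hsK _) (fun i => hqK _) (fun i => hzK _)
        (fun i => hψK _) hH.reward hH.cross hθ hm (hR.trans hr1) hxR hwR hη₁.le hη₁K hη₁l
        (hrad R hR))
    (fun t R hR hxR hwR => by
      rw [hw']
      refine norm_sub_smul_blockGrad_le hn hK1 (fun i => hqK _) (fun i => hsK _) (fun i => hψK _)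
        (fun i => hzK _) ?_ ?_ ?_ hm (hR.trans hr1) hwR hxR hη₂.le hη₂K hη₂l (hrad R hR)
      · intro k
        simpa only [trueLogit, mul_comm (F.scale γs _)] using hH.scale k
      · intro k h
        have := hH.cross h k
        rw [mul_comm ‖h‖] at this
        simpa only [trueLogit, mul_comm (F.scale γs _), mul_comm (inner ℝ (F.featureDiff _) h)]
          using this
      · simpa only [scaleNoise, trueLogit, mul_comm (F.scale γs _)] using hγ) T
  have h1 := sq_add_le_of_pow hκ (norm_nonneg (x T)) (fun h => by rw [h]; exact hθ₀) hiter.1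
  have h2 := sq_add_le_of_pow hκ (norm_nonneg (w T)) (fun h => by rw [h]; exact hγ₀) hiter.2
  calc _ ≤ _ := add_le_add h1 h2
    _ = _ := by ring

variable {Ω : Type*} [MeasurableSpace Ω] {P : Measure Ω} [IsProbabilityMeasure P]
  {ν : Measure (Comparison 𝒳 𝒮 𝒜)} {θs : Vec d₁} {γs : Vec d₂} {n : ℕ}
  {ctx : Fin n → Ω → Comparison 𝒳 𝒮 𝒜} {Y : Fin n → Ω → ℝ}

variable {F}

/-- The Hessian at the truth inherits the coercivity and the coupling of the population, up to
`D² τ`, unless one of its at most `3 D²` entries deviates by `τ`. The lower bound `κ` of `μ(1 - μ)`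
at the true logits turns the design eigenvalues into curvature. -/
theorem measure_not_hessianBounds_le [IsProbabilityMeasure ν] (hn : 0 < n)
    (h : F.IsPreferenceSample P ν θs γs ctx Y) {K τ κ lamφ lamψ lam m D : ℝ} (hK1 : 1 ≤ K)
    (hsK : ∀ x, |F.scale γs x| ≤ K) (hqK : ∀ c, |inner ℝ θs (F.featureDiff c)| ≤ K)
    (hzK : ∀ c, ‖F.featureDiff c‖ ≤ K) (hψK : ∀ x, ‖F.ψ x‖ ≤ K) (hτ : 0 ≤ τ) (hκ : 0 ≤ κ)
    (hκw : ∀ c, κ ≤ Real.sigmoid (F.trueLogit θs γs c) * (1 - Real.sigmoid (F.trueLogit θs γs c)))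
    (hev : F.DesignEigenvalues ν θs γs lamφ lamψ) (hd₁ : (d₁ : ℝ) ≤ D) (hd₂ : (d₂ : ℝ) ≤ D)
    (hlamφ : lam + D * D * τ ≤ κ * lamφ) (hlamψ : lam + D * D * τ ≤ κ * lamψ)
    (hm : F.coupling ν θs γs + D * D * τ ≤ m) :
    P.real {ω | ¬ F.HessianBounds θs γs (fun i => ctx i ω) (fun i => Y i ω) lam m}
      ≤ 3 * (D * D) * (2 * Real.exp (-(n * τ ^ 2 / (2 * (2 * K ^ 4) ^ 2)))) := by
  have hψm := F.measurable_ψ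
  have hD : 0 ≤ D := (Nat.cast_nonneg _).trans hd₁
  set e := 2 * Real.exp (-(n * τ ^ 2 / (2 * (2 * K ^ 4) ^ 2))) with he
  have he0 : 0 ≤ e := by positivity
  set w : Comparison 𝒳 𝒮 𝒜 → ℝ := fun c =>
    Real.sigmoid (F.trueLogit θs γs c) * (1 - Real.sigmoid (F.trueLogit θs γs c)) with hw
  have hσ := continuous_sigmoid.measurable
  have hwm : Measurable w := by fun_prop
  have hind : iIndepFun ctx P := h.indep.comp (fun _ => Prod.fst) fun _ => measurable_fst
  have h1 := measure_not_coercive_le (w := w) (τ := τ) hn h.measurable_ctx hind h.ctx_law hwm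
    (F.measurable_scale γs) F.measurable_featureDiff hκ hκw
    (fun c => Real.sigmoid_mul_one_sub_le_one _) (fun c => hsK c.1) hzK hev.reward hτ
  have h2 := measure_not_coercive_le (w := w) (τ := τ) (a := fun c => F.ψ c.1)
    (s := fun c => inner ℝ θs (F.featureDiff c)) hn h.measurable_ctx hind h.ctx_law hwm
    (by fun_prop) (by fun_prop) hκ hκw
    (fun c => Real.sigmoid_mul_one_sub_le_one _) hqK (fun c => hψK c.1) hev.scale hτ
  have h3 := measure_not_cross_le hn h hK1 hsK hqK hzK hψK hτ
  rw [← he] at h1 h2 h3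
  have hdd : ∀ {p q : ℕ}, (p : ℝ) ≤ D → (q : ℝ) ≤ D → (p * q : ℝ) ≤ D * D := fun hp hq =>
    mul_le_mul hp hq (Nat.cast_nonneg _) hD
  have h11 := mul_le_mul_of_nonneg_right (hdd hd₁ hd₁) he0
  have h22 := mul_le_mul_of_nonneg_right (hdd hd₂ hd₂) he0
  have h12 := mul_le_mul_of_nonneg_right (hdd hd₁ hd₂) he0
  refine (measureReal_mono (s₂ := _ ∪ (_ ∪ _)) ?_ (measure_ne_top _ _)).trans
    ((measureReal_union_le _ _).trans
    ((add_le_add h1 ((measureReal_union_le _ _).trans (add_le_add h2 h3))).trans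
      (by linarith)))
  intro ω hω
  by_contra hcon
  simp only [mem_union, mem_ofPred_eq, not_or, not_not] at hcon
  obtain ⟨c1, c2, c3⟩ := hcon
  refine hω ⟨fun v => ?_, fun v => ?_, fun v k => ?_⟩
  · refine le_trans ?_ (c1 v)
    have := mul_le_mul_of_nonneg_right (hdd hd₁ hd₁) hτ
    gcongr
    linarith
  · refine le_trans ?_ (c2 v)
    have := mul_le_mul_of_nonneg_right (hdd hd₂ hd₂) hτ
    gcongr
    linarith
  · refine (c3 v k).trans ?_
    have := mul_le_mul_of_nonneg_right (hdd hd₁ hd₂) hτ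
    gcongr
    linarith

/-- Both gradient noises are at most `D t`, unless one of their at most `D` coordinates
exceeds `t`. -/
theorem measure_not_noise_le (hn : 0 < n)
    (h : F.IsPreferenceSample P ν θs γs ctx Y) {K t D : ℝ} (hK1 : 1 ≤ K)
    (hsK : ∀ x, |F.scale γs x| ≤ K) (hqK : ∀ c, |inner ℝ θs (F.featureDiff c)| ≤ K)
    (hzK : ∀ c, ‖F.featureDiff c‖ ≤ K) (hψK : ∀ x, ‖F.ψ x‖ ≤ K) (ht : 0 ≤ t)
    (hd : (d₁ + d₂ : ℝ) ≤ D) :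
    P.real {ω | ¬ (‖F.rewardNoise θs γs (fun i => ctx i ω) (fun i => Y i ω)‖ ≤ D * t ∧
        ‖F.scaleNoise θs γs (fun i => ctx i ω) (fun i => Y i ω)‖ ≤ D * t)}
      ≤ D * (2 * Real.exp (-(n * t ^ 2 / (2 * (2 * K ^ 4) ^ 2)))) := by
  have hψm := F.measurable_ψ
  have hσ := continuous_sigmoid.measurable
  have hK0 : 0 ≤ K := zero_le_one.trans hK1
  set e := 2 * Real.exp (-(n * t ^ 2 / (2 * (2 * K ^ 4) ^ 2))) with he
  have he0 : 0 ≤ e := by positivity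
  have hXm : ∀ i, Measurable fun ω => (ctx i ω, Y i ω) := fun i =>
    (h.measurable_ctx i).prodMk (h.measurable_label i)
  -- Both noises are averages of `(μ(u) - y) s(c) • a(c)` with bounded `s` and `a`.
  have gen : ∀ {d : ℕ} (s : Comparison 𝒳 𝒮 𝒜 → ℝ) (a : Comparison 𝒳 𝒮 𝒜 → Vec d),
      Measurable s → Measurable a → (∀ c, |s c| ≤ K) → (∀ c, ‖a c‖ ≤ K) →
      P.real {ω | ¬ ‖(1 / (n : ℝ)) • ∑ i, ((Real.sigmoid (F.trueLogit θs γs (ctx i ω)) - Y i ω)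
        * s (ctx i ω)) • a (ctx i ω)‖ ≤ d * t} ≤ d * e := by
    intro d s a hs ha hsb hab
    refine measure_noise_gt_le (X := fun i ω => (ctx i ω, Y i ω))
      (g := fun x => (Real.sigmoid (F.trueLogit θs γs x.1) - x.2) * s x.1) hn hXm h.indep
      (by fun_prop) ha hK1 (fun i ω => ?_) hab (fun i j => ?_) ht
    · rw [abs_mul]
      calc _ ≤ 1 * K := mul_le_mul (abs_sub_label_le_one (h.label_mem i ω)) (hsb _)
            (abs_nonneg _) zero_le_one
        _ = K := one_mul K
    · have := integral_residual_mul_eq_zero h i (g := fun c => s c * a c j) (by fun_prop)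
        (K := K * K) (fun c => by
          rw [abs_mul]
          exact mul_le_mul (hsb c) ((PiLp.norm_apply_le (a c) j).trans (hab c))
            (abs_nonneg _) hK0)
      simpa only [mul_assoc] using this
  have h1 := gen (fun c => F.scale γs c.1) F.featureDiff (by fun_prop) (by fun_prop)
    (fun c => hsK c.1) hzK
  have h2 := gen (fun c => inner ℝ θs (F.featureDiff c)) (fun c => F.ψ c.1) (by fun_prop)
    (by fun_prop) hqK (fun c => hψK c.1)
  have hde := mul_le_mul_of_nonneg_right hd he0
  refine (measureReal_mono (s₂ := _ ∪ _) ?_ (measure_ne_top _ _)).trans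
    ((measureReal_union_le _ _).trans
    ((add_le_add h1 h2).trans (by linarith)))
  intro ω hω
  by_contra hcon
  simp only [mem_union, mem_ofPred_eq, not_or, not_not] at hcon
  have e1 : (d₁ : ℝ) * t ≤ D * t := by
    gcongr; linarith [Nat.cast_nonneg (α := ℝ) d₂]
  have e2 : (d₂ : ℝ) * t ≤ D * t := by
    gcongr; linarith [Nat.cast_nonneg (α := ℝ) d₁]
  exact hω ⟨hcon.1.trans e1, hcon.2.trans e2⟩

end FeatureMaps

/-- For large `n`, an exponentially small tail is below `1 / n`. -/
theorem exists_nat_mul_exp_neg_le_one_div {N a : ℝ} (ha : 0 < a) :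
    ∃ n₀ : ℕ, 0 < n₀ ∧ ∀ n : ℕ, n₀ < n → N * Real.exp (-(n * a)) ≤ 1 / (n : ℝ) := by
  refine ⟨⌈2 * N / a ^ 2⌉₊ + 1, Nat.succ_pos _, fun n hn => ?_⟩
  have h1 : 2 * N / a ^ 2 ≤ n := (Nat.le_ceil _).trans (by exact_mod_cast (by omega))
  have hn0 : (0 : ℝ) < n := by exact_mod_cast (by omega : 0 < n)
  have h2 := Real.quadratic_le_exp_of_nonneg (x := n * a) (by positivity)
  rw [div_le_iff₀ (by positivity)] at h1
  rw [Real.exp_neg, ← div_eq_mul_inv, div_le_div_iff₀ (Real.exp_pos _) hn0]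
  have h3 : 0 < n * a := by positivity
  nlinarith

/-! ### Choice of the constants -/

theorem one_sub_le_measure_of_tail_le {Ω : Type*} [MeasurableSpace Ω] {P : Measure Ω}
    [IsProbabilityMeasure P] {A B G : Set Ω} {p q : ℝ} (hA : P.real A ≤ p) (hB : P.real B ≤ q)
    (hG : ∀ ω, ω ∉ A → ω ∉ B → ω ∈ G) : 1 - p - q ≤ P.real G := by
  have hcover : (univ : Set Ω) ⊆ G ∪ (A ∪ B) := fun ω _ => by
    by_cases h1 : ω ∈ A
    · exact Or.inr (Or.inl h1)
    by_cases h2 : ω ∈ B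
    · exact Or.inr (Or.inr h2)
    exact Or.inl (hG ω h1 h2)
  have h1 := measureReal_mono (μ := P) hcover
  rw [probReal_univ] at h1
  have h2 := measureReal_union_le (μ := P) G (A ∪ B)
  have h3 := measureReal_union_le (μ := P) A B
  linarith

/-- The noise level `t` at confidence `δ`: for `δ ≤ δmax` the logarithm of the number `2 D` of tail
events is absorbed into a multiple of `log (1 / δ)`. -/
theorem mul_two_mul_exp_neg_le {D V n δ δmax t : ℝ} (hD : 1 ≤ D) (hV : 0 < V) (hn : 0 < n)
    (hδ0 : 0 < δ) (hδ : δ ≤ δmax) (hδmax : δmax < 1)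
    (ht : t ^ 2 = V * (1 + Real.log (2 * D) / Real.log (1 / δmax)) * Real.log (1 / δ) / n) :
    D * (2 * Real.exp (-(n * t ^ 2 / V))) ≤ δ := by
  have hδmax0 : 0 < δmax := hδ0.trans_le hδ
  have hLmax : 0 < Real.log (1 / δmax) :=
    Real.log_pos (by rw [lt_div_iff₀ hδmax0]; linarith)
  have hle : Real.log (1 / δmax) ≤ Real.log (1 / δ) :=
    Real.log_le_log (by positivity) (one_div_le_one_div_of_le hδ0 hδ)
  have hlogD : 0 ≤ Real.log (2 * D) := Real.log_nonneg (by linarith)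
  have h1 : n * t ^ 2 / V
      = Real.log (1 / δ) + Real.log (2 * D) * (Real.log (1 / δ) / Real.log (1 / δmax)) := by
    rw [ht]
    field_simp
  have h2 : Real.log (2 * D) + Real.log (1 / δ) ≤ n * t ^ 2 / V := by
    rw [h1]
    have h3 : 1 ≤ Real.log (1 / δ) / Real.log (1 / δmax) := (one_le_div hLmax).2 hle
    nlinarith
  have h4 : Real.exp (-(n * t ^ 2 / V)) ≤ δ / (2 * D) := by
    rw [← Real.exp_log (show (0 : ℝ) < δ / (2 * D) by positivity)]
    refine Real.exp_le_exp.2 ?_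
    rw [Real.log_div hδ0.ne' (by positivity)]
    rw [one_div δ, Real.log_inv] at h2
    linarith
  calc D * (2 * Real.exp (-(n * t ^ 2 / V))) ≤ D * (2 * (δ / (2 * D))) := by gcongr
    _ = δ := by field_simp

/-- The high-probability bound for one sample size, in terms of a Hessian accuracy `τ` and a
noise level `t`. The events that the Hessian at the truth is inaccurate, or that the noise would
drive the iterates out of the ball of radius `r`, cost `1 / n`; the event that the noise exceeds
its level `t` costs `δ`. -/
theorem FeatureMaps.one_sub_le_measure_altGD_error_le {𝒳 𝒮 𝒜 : Type*} [MeasurableSpace 𝒳]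
    [MeasurableSpace 𝒮] [MeasurableSpace 𝒜] {d₁ d₂ : ℕ} {F : FeatureMaps 𝒳 𝒮 𝒜 d₁ d₂}
    {ν : Measure (Comparison 𝒳 𝒮 𝒜)} [IsProbabilityMeasure ν] {θs : Vec d₁} {γs : Vec d₂}
    {Ω : Type*} [MeasurableSpace Ω] {P : Measure Ω} [IsProbabilityMeasure P] {n : ℕ} (hn : 0 < n)
    {ctx : Fin n → Ω → Comparison 𝒳 𝒮 𝒜} {Y : Fin n → Ω → ℝ}
    (hsample : F.IsPreferenceSample P ν θs γs ctx Y)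
    {K κ lamφ lamψ lam m a r τ t D b δ η₁ η₂ : ℝ} (hK1 : 1 ≤ K)
    (hsK : ∀ x, |F.scale γs x| ≤ K) (hqK : ∀ c, |inner ℝ θs (F.featureDiff c)| ≤ K)
    (hzK : ∀ c, ‖F.featureDiff c‖ ≤ K) (hψK : ∀ x, ‖F.ψ x‖ ≤ K) (hκ : 0 ≤ κ)
    (hκw : ∀ c, κ ≤ Real.sigmoid (F.trueLogit θs γs c) * (1 - Real.sigmoid (F.trueLogit θs γs c)))
    (hev : F.DesignEigenvalues ν θs γs lamφ lamψ) (hd : (d₁ + d₂ : ℝ) ≤ D)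
    (hlamφ : lam + D * D * τ ≤ κ * lamφ) (hlamψ : lam + D * D * τ ≤ κ * lamψ)
    (hm : F.coupling ν θs γs + D * D * τ ≤ m) (hm0 : 0 ≤ m)
    (ha : 0 < a) (hr : 0 < r) (hr1 : r ≤ 1) (ham : a + m + 13 * K ^ 6 * r ≤ lam / 2)
    (hτ : 0 ≤ τ) (hDτ : D * τ ≤ a * r / 2) (ht : 0 ≤ t)
    (hδ : D * (2 * Real.exp (-(n * t ^ 2 / (2 * (2 * K ^ 4) ^ 2)))) ≤ δ)
    (hexp : (3 * (D * D) + D) * 2 * Real.exp (-(n * (τ ^ 2 / (2 * (2 * K ^ 4) ^ 2)))) ≤ 1 / n)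
    (hη₁ : 0 < η₁) (hη₂ : 0 < η₂) (hη₁K : η₁ * (K ^ 4) ^ 2 ≤ lam) (hη₂K : η₂ * (K ^ 4) ^ 2 ≤ lam)
    (hη₁l : η₁ * lam ≤ 2) (hη₂l : η₂ * lam ≤ 2) (hρ : 1 - a * min η₁ η₂ ∈ Ioo (0 : ℝ) 1)
    (hb : b ≤ r / 2) {θ₀ : Vec d₁} {γ₀ : Vec d₂}
    (hθ₀ : ‖θ₀ - θs‖ ≤ b / Real.sqrt 2) (hγ₀ : ‖γ₀ - γs‖ ≤ b / Real.sqrt 2) (T : ℕ) :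
    1 - δ - 1 / (n : ℝ) ≤ P.real {ω |
      ‖(altGD (F.negLogLik (fun i => ctx i ω) (fun i => Y i ω)) η₁ η₂ θ₀ γ₀ T).1 - θs‖ ^ 2
      + ‖(altGD (F.negLogLik (fun i => ctx i ω) (fun i => Y i ω)) η₁ η₂ θ₀ γ₀ T).2 - γs‖ ^ 2
      ≤ (1 - a * min η₁ η₂) ^ T * b ^ 2
        + 2 * ((D * t / a) ^ 2 / (1 - (1 - a * min η₁ η₂)))} := by
  have hd₁ : (d₁ : ℝ) ≤ D := by linarith [Nat.cast_nonneg (α := ℝ) d₂]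
  have hd₂ : (d₂ : ℝ) ≤ D := by linarith [Nat.cast_nonneg (α := ℝ) d₁]
  have hD : 0 ≤ D := (Nat.cast_nonneg _).trans hd₁
  have hA := (FeatureMaps.measure_not_noise_le hn hsample hK1 hsK hqK hzK hψK ht hd).trans hδ
  have hB₁ := FeatureMaps.measure_not_hessianBounds_le hn hsample hK1 hsK hqK hzK hψK hτ hκ hκw
    hev hd₁ hd₂ hlamφ hlamψ hm
  have hB₂ := FeatureMaps.measure_not_noise_le hn hsample hK1 hsK hqK hzK hψK hτ hd
  have hB := (measureReal_union_le _ _).trans ((add_le_add hB₁ hB₂).trans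
    (le_of_eq_of_le (by rw [mul_div_assoc]; ring) hexp))
  refine one_sub_le_measure_of_tail_le hA hB fun ω hωA hωB => ?_
  simp only [mem_union, mem_ofPred_eq, not_or, not_not] at hωA hωB
  obtain ⟨hH, hN⟩ := hωB
  obtain ⟨ε, hε⟩ : ∃ ε, ε = min (D * t) (a * r / 2) := ⟨_, rfl⟩
  have hεt : ε ≤ D * t := hε ▸ min_le_left _ _
  have hεr : ε ≤ a * r / 2 := hε ▸ min_le_right _ _
  have hε0 : 0 ≤ ε := by rw [hε]; exact le_min (by positivity) (by positivity)
  have hb0 : 0 ≤ b := by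
    by_contra hneg
    have : b / Real.sqrt 2 < 0 := div_neg_of_neg_of_pos (not_le.1 hneg) (by positivity)
    linarith [norm_nonneg (θ₀ - θs)]
  have hbE : b / Real.sqrt 2 ≤ r / 2 :=
    (div_le_self hb0 (Real.one_le_sqrt.2 one_le_two)).trans hb
  have hεa : ε / a ≤ r / 2 := by
    rw [div_le_iff₀ ha]
    linarith
  have hmain := F.norm_altGD_sub_sq_add_le (ε := ε) (E₀ := b / Real.sqrt 2) hn hK1 hsK hqK hzK
    hψK hH (by rw [hε]; exact le_min hωA.1 (hN.1.trans hDτ))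
    (by rw [hε]; exact le_min hωA.2 (hN.2.trans hDτ)) ha hm0 hr.le hr1 ham hη₁ hη₂ hη₁K hη₂K
    hη₁l hη₂l hθ₀ hγ₀ (by linarith) hρ T
  refine hmain.trans (add_le_add (le_of_eq ?_) ?_)
  · rw [div_pow, Real.sq_sqrt zero_le_two]
    ring
  · have hρ' : 0 < 1 - (1 - a * min η₁ η₂) := sub_pos.2 hρ.2
    gcongr

theorem mainTheorem1 (d₁ d₂ : ℕ)
    (φmax θmax ψmax γmax lamφ lamψ M : ℝ)
    (hφmax : 0 < φmax) (hθmax : 0 < θmax) (hψmax : 0 < ψmax) (hγmax : 0 < γmax)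
    (hlamφ : 0 < lamφ) (hlamψ : 0 < lamψ)
    (hM : M < min lamφ lamψ / (6 * curvatureConst d₁ d₂ φmax θmax ψmax γmax lamφ lamψ)) :
    ∃ b₀ : ℝ, 0 < b₀ ∧ ∃ η₀ : ℝ, 0 < η₀ ∧ ∃ n₀ : ℕ, 0 < n₀ ∧
    ∃ c₁ : ℝ → ℝ, (∀ δmax ∈ Ioo (0 : ℝ) 1, 0 < c₁ δmax) ∧
    ∀ η₁ ∈ Ioo 0 η₀, ∀ η₂ ∈ Ioo 0 η₀, ∃ ρ ∈ Ioo (0 : ℝ) 1,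
    ∀ (𝒳 : Type*) (𝒮 : Type*) (𝒜 : Type*)
      [MeasurableSpace 𝒳] [MeasurableSpace 𝒮] [MeasurableSpace 𝒜]
      (F : FeatureMaps 𝒳 𝒮 𝒜 d₁ d₂)
      (ν : Measure (Comparison 𝒳 𝒮 𝒜)) [IsProbabilityMeasure ν]
      (θs : Vec d₁) (γs : Vec d₂),
      F.BoundedReward θs φmax θmax →
      F.BoundedScale γs ψmax γmax →
      F.DesignEigenvalues ν θs γs lamφ lamψ →
      F.coupling ν θs γs = M →
    ∀ (Ω : Type*) [MeasurableSpace Ω] (P : Measure Ω) [IsProbabilityMeasure P]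
      (n : ℕ), n₀ < n →
    ∀ (ctx : Fin n → Ω → Comparison 𝒳 𝒮 𝒜) (Y : Fin n → Ω → ℝ),
      F.IsPreferenceSample P ν θs γs ctx Y →
    ∀ (b : ℝ), b < b₀ →
    ∀ (θ₀ : Vec d₁) (γ₀ : Vec d₂),
      ‖θ₀ - θs‖ ≤ b / Real.sqrt 2 → ‖γ₀ - γs‖ ≤ b / Real.sqrt 2 →
    ∀ (T : ℕ) (δmax : ℝ), δmax ∈ Ioo (0 : ℝ) 1 → ∀ δ : ℝ, 0 < δ → δ ≤ δmax →
      1 - δ - 1 / (n : ℝ) ≤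
        P.real {ω |
          ‖(altGD (F.negLogLik (fun i => ctx i ω) (fun i => Y i ω)) η₁ η₂ θ₀ γ₀ T).1 - θs‖ ^ 2
          + ‖(altGD (F.negLogLik (fun i => ctx i ω) (fun i => Y i ω)) η₁ η₂ θ₀ γ₀ T).2 - γs‖ ^ 2
          ≤ ρ ^ T * b ^ 2 + c₁ δmax * Real.log (1 / δ) / ((1 - ρ) * n)} := by
  obtain ⟨κ, hκdef⟩ : ∃ x : ℝ, x = Real.exp (logitBound d₁ d₂ φmax θmax ψmax γmax lamφ lamψ)
    / (1 + Real.exp (logitBound d₁ d₂ φmax θmax ψmax γmax lamφ lamψ)) ^ 2 := ⟨_, rfl⟩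
  have hκ : 0 < κ := by rw [hκdef]; positivity
  obtain ⟨lam₀, hlam₀def⟩ : ∃ x : ℝ, x = κ * min lamφ lamψ := ⟨_, rfl⟩
  have hlam₀ : 0 < lam₀ := hlam₀def ▸ mul_pos hκ (lt_min hlamφ hlamψ)
  have hlam₀φ : lam₀ ≤ κ * lamφ := by rw [hlam₀def]; gcongr; exact min_le_left _ _
  have hlam₀ψ : lam₀ ≤ κ * lamψ := by rw [hlam₀def]; gcongr; exact min_le_right _ _
  have hM6 : M < lam₀ / 6 := by
    refine lt_of_lt_of_eq hM ?_
    rw [curvatureConst, hlam₀def, hκdef]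
    field_simp
  obtain ⟨S, hSdef⟩ : ∃ x : ℝ, x = Real.sqrt (d₂ + 1) * γmax * ψmax := ⟨_, rfl⟩
  obtain ⟨Q, hQdef⟩ : ∃ x : ℝ, x = Real.sqrt d₁ * θmax * (2 * φmax) := ⟨_, rfl⟩
  have hS : 0 ≤ S := by rw [hSdef]; positivity
  have hQ : 0 ≤ Q := by rw [hQdef]; positivity
  have hSQ : S * Q ≤ logitBound d₁ d₂ φmax θmax ψmax γmax lamφ lamψ := by
    rw [hSdef, hQdef]
    exact two_mul_le_logitBound d₁ d₂ hφmax hθmax hψmax hγmax hlamφ hlamψ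
  obtain ⟨K, hKdef⟩ : ∃ x : ℝ, x = 1 + ψmax + 2 * φmax + S + Q := ⟨_, rfl⟩
  have hK1 : 1 ≤ K := by linarith
  have hK0 : 0 < K := by linarith
  obtain ⟨D, hDdef⟩ : ∃ x : ℝ, x = d₁ + d₂ + 1 := ⟨_, rfl⟩
  have hdD : (d₁ + d₂ : ℝ) ≤ D := by linarith
  have hD1 : 1 ≤ D := by
    have : (0 : ℝ) ≤ d₁ + d₂ := by positivity
    linarith
  have hD0 : 0 < D := by linarith
  -- Contraction rate, radius of the contraction region, and Hessian accuracy: the coercivity is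
  -- `23/24 lam₀` and the coupling `5/24 lam₀`, so that `13 K⁶ r ≤ 2/24 lam₀` leaves room for `a`.
  obtain ⟨a, hadef⟩ : ∃ x : ℝ, x = lam₀ / 8 := ⟨_, rfl⟩
  have ha : 0 < a := by linarith
  obtain ⟨r, hr, hr1, hrK⟩ : ∃ r : ℝ, 0 < r ∧ r ≤ 1 ∧ 13 * K ^ 6 * r ≤ lam₀ / 12 := by
    refine ⟨min 1 (lam₀ / 12 / (13 * K ^ 6)), lt_min one_pos (by positivity), min_le_left _ _, ?_⟩
    rw [← le_div_iff₀' (by positivity)]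
    exact min_le_right _ _
  obtain ⟨τ, hτ, hDDτ, hDτ⟩ : ∃ τ : ℝ, 0 < τ ∧ D * D * τ ≤ lam₀ / 24 ∧ D * τ ≤ a * r / 2 := by
    refine ⟨min (lam₀ / 24 / (D * D)) (a * r / 2 / D), lt_min (by positivity) (by positivity),
      ?_, ?_⟩
    · rw [← le_div_iff₀' (by positivity)]
      exact min_le_left _ _
    · rw [← le_div_iff₀' (by positivity)]
      exact min_le_right _ _
  obtain ⟨V, hVdef⟩ : ∃ x : ℝ, x = 2 * (2 * K ^ 4) ^ 2 := ⟨_, rfl⟩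
  have hV : 0 < V := by rw [hVdef]; positivity
  obtain ⟨n₀, hn₀, hexp⟩ := exists_nat_mul_exp_neg_le_one_div (N := (3 * (D * D) + D) * 2)
    (a := τ ^ 2 / V) (by positivity)
  obtain ⟨lam, hlamdef⟩ : ∃ x : ℝ, x = 23 / 24 * lam₀ := ⟨_, rfl⟩
  have hlam : 0 < lam := by linarith
  obtain ⟨η₀, hη₀, hηK, hηl⟩ : ∃ η₀ : ℝ, 0 < η₀ ∧ (∀ η < η₀, η * (K ^ 4) ^ 2 ≤ lam) ∧
      ∀ η < η₀, η * lam₀ < 1 :=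
    ⟨min (lam / (K ^ 4) ^ 2) (1 / lam₀), lt_min (by positivity) (by positivity),
      fun η h => (le_div_iff₀ (by positivity)).1 (h.le.trans (min_le_left _ _)),
      fun η h => (lt_div_iff₀ hlam₀).1 (h.trans_le (min_le_right _ _))⟩
  have hlogδ : ∀ δ ∈ Ioo (0 : ℝ) 1, 0 < Real.log (1 / δ) := fun δ hδ =>
    Real.log_pos (by rw [lt_div_iff₀ hδ.1]; linarith [hδ.2])
  have hcpos : ∀ δmax ∈ Ioo (0 : ℝ) 1,
      0 < V * (1 + Real.log (2 * D) / Real.log (1 / δmax)) := fun δ hδ => by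
    have := hlogδ δ hδ
    have : 0 ≤ Real.log (2 * D) := Real.log_nonneg (by linarith)
    positivity
  refine ⟨r / 2, by positivity, η₀, hη₀, n₀, hn₀, fun δmax =>
    2 * D ^ 2 * (V * (1 + Real.log (2 * D) / Real.log (1 / δmax))) / a ^ 2, fun δmax hδ => ?_, ?_⟩
  · have := hcpos δmax hδ
    exact div_pos (mul_pos (by positivity) this) (by positivity)
  rintro η₁ ⟨hη₁, hη₁'⟩ η₂ ⟨hη₂, hη₂'⟩
  have hρ : 1 - a * min η₁ η₂ ∈ Ioo (0 : ℝ) 1 := by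
    have h1 : 0 < a * min η₁ η₂ := mul_pos ha (lt_min hη₁ hη₂)
    have h2 : a * min η₁ η₂ ≤ a * η₁ := mul_le_mul_of_nonneg_left (min_le_left _ _) ha.le
    have h3 : a * η₁ < 1 := by
      have := hηl η₁ hη₁'
      rw [hadef]
      linarith
    exact ⟨by linarith, by linarith⟩
  refine ⟨1 - a * min η₁ η₂, hρ, ?_⟩
  intro 𝒳 𝒮 𝒜 _ _ _ F ν _ θs γs hBR hBS hev hcoup Ω _ P _ n hn ctx Y hsample b hb θ₀ γ₀ hθ₀ hγ₀
    T δmax hδmax δ hδ0 hδ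
  have hn' : 0 < n := hn₀.trans hn
  have hnR : (0 : ℝ) < n := by exact_mod_cast hn'
  have hsS : ∀ x, |F.scale γs x| ≤ S := fun x => hSdef ▸ F.abs_scale_le hBS x
  have hqQ : ∀ c, |inner ℝ θs (F.featureDiff c)| ≤ Q := fun c =>
    hQdef ▸ F.abs_inner_featureDiff_le hθmax hBR c
  have hκw : ∀ c, κ ≤ Real.sigmoid (F.trueLogit θs γs c)
      * (1 - Real.sigmoid (F.trueLogit θs γs c)) := fun c => by
    rw [hκdef]
    refine Real.exp_div_le_sigmoid_mul_one_sub (le_trans ?_ hSQ)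
    rw [FeatureMaps.trueLogit, abs_mul]
    exact mul_le_mul (hsS _) (hqQ c) (abs_nonneg _) hS
  have hLδ := hlogδ δ ⟨hδ0, hδ.trans_lt hδmax.2⟩
  obtain ⟨t, ht0, ht⟩ : ∃ t : ℝ, 0 ≤ t ∧
      t ^ 2 = V * (1 + Real.log (2 * D) / Real.log (1 / δmax)) * Real.log (1 / δ) / n :=
    ⟨_, Real.sqrt_nonneg _, Real.sq_sqrt
      (div_nonneg (mul_nonneg (hcpos δmax hδmax).le hLδ.le) hnR.le)⟩
  have htail := mul_two_mul_exp_neg_le hD1 hV hnR hδ0 hδ hδmax.2 ht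
  have hexp' := hexp n hn
  rw [hVdef] at htail hexp'
  have hbound := FeatureMaps.one_sub_le_measure_altGD_error_le (lam := lam) (m := 5 / 24 * lam₀)
    (δ := δ) (b := b) hn' hsample hK1 (fun x => (hsS x).trans (by linarith))
    (fun c => (hqQ c).trans (by linarith))
    (fun c => (F.norm_featureDiff_le hBR c).trans (by linarith))
    (fun x => (F.norm_scaleFeature_le hBS x).trans (by linarith)) hκ.le hκw hev hdD
    (by linarith) (by linarith) (by rw [hcoup]; linarith) (by linarith) ha hr hr1 (by linarith)
    hτ.le hDτ ht0 htail hexp' hη₁ hη₂ (hηK η₁ hη₁') (hηK η₂ hη₂')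
    (by have := hηl η₁ hη₁'; rw [hlamdef]; linarith)
    (by have := hηl η₂ hη₂'; rw [hlamdef]; linarith) hρ hb.le hθ₀ hγ₀ T
  have hrate : 2 * ((D * t / a) ^ 2 / (1 - (1 - a * min η₁ η₂)))
      = 2 * D ^ 2 * (V * (1 + Real.log (2 * D) / Real.log (1 / δmax))) / a ^ 2
        * Real.log (1 / δ) / ((1 - (1 - a * min η₁ η₂)) * n) := by
    have hρ' := (sub_pos.2 hρ.2).ne'
    generalize 1 - (1 - a * min η₁ η₂) = q at hρ' ⊢
    rw [div_pow, mul_pow, ht]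
    field_simp
  rw [hrate] at hbound
  exact hbound
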